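/- Let $T_n$ be the 4-regular torus on $n=m^2$ vertices, $m\ge 3$ (the Cartesian product of two cycles of length $m$). Let $n=tk$, and let $n$ agents, $k$ of each of $t$ types, be placed bijectively on the vertices (an assignment). The utility $U_\#(A)$ of an agent $A$ is the number of its neighbours whose type differs from that of $A$. A move swaps the locations of two agents, both of whose utilities strictly increase by the swap; an assignment is an equilibrium if there is no move. The social welfare $\mathrm{SW}(L)$ of an assignment $L$ is the sum of all utilities, and $\mathrm{PoA}$ is the maximum of $\mathrm{SW}$ over all assignments divided by the minimum of $\mathrm{SW}$ over all equilibria (equilibria exist and have positive welfare). Below, $k\to\infty$ with $t$ fixed, along all $k$ for which $tk$ is a perfect square. (a) For $t=2$, every equilibrium has $\mathrm{SW}\ge 4.8\,k$; if $10\mid m$, some equilibrium whose type pattern depends only on the two coordinates modulo $10$ has $\mathrm{SW}=4.8\,k$; and $\mathrm{PoA}\to 5/3$ as $k\to\infty$. (b) For every $t\ge 3$, $\liminf_{k\to\infty}\mathrm{PoA}\ge \dfrac{t}{t-1}$. For every $t\ge 3$ and every $k$ we have $\mathrm{PoA}\le \dfrac43\cdot\dfrac{t}{t-1}$, and if $t\ge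 4$ then $\mathrm{PoA}\le \min\left\{\dfrac{t}{t-13/4},\ \dfrac43\cdot\dfrac{t}{t-1}\right\}$. -/

import Mathlib

namespace DiversitySwap

universe u v

/-- An assignment of the agents `X` to the vertices `V`: a bijection. -/
abbrev Assignment (X : Type u) (V : Type v) := X ≃ V

/-- A utility: the value of an agent under an assignment. -/
abbrev Utility (X : Type u) (V : Type v) := Assignment X V → X → ℝ

open Classical in
/-- The assignment obtained from `L` by interchanging the locations of the agents `A` and `B`. -/
noncomputable def swapLocations {X : Type u} {V : Type v} (L : Assignment X V) (A B : X) :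
    Assignment X V :=
  (Equiv.swap A B).trans L

/-- Interchanging the locations of `A` and `B` is a move of the swap game under `U`:
both agents strictly increase their utilities. -/
def IsMove {X : Type u} {V : Type v} (U : Utility X V) (L : Assignment X V) (A B : X) : Prop :=
  U L A < U (swapLocations L A B) A ∧ U L B < U (swapLocations L A B) B

/-- The equilibrium assignments of the swap game under `U`: those that admit no move. -/
def equilibria {X : Type u} {V : Type v} (U : Utility X V) : Set (Assignment X V) :=
  {L | ∀ A B : X, ¬ IsMove U L A B}

/-- The social welfare of an assignment: the sum of the utilities of all agents. -/
noncomputable def socialWelfare {X : Type u} {V : Type v} [Fintype X] (U : Utility X V)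
    (L : Assignment X V) : ℝ :=
  ∑ A : X, U L A

open Classical in
/-- The difference-seeking utility `U_#`: the number of agents that are neighbours of `A` under
the assignment and have a type different from that of `A`. -/
noncomputable def differenceSeeking {X : Type u} {V : Type v} {T : Type*} [Fintype X]
    (G : SimpleGraph V) (type : X → T) : Utility X V :=
  fun L A => ((Finset.univ.filter
    (fun B : X => G.Adj (L A) (L B) ∧ type B ≠ type A)).card : ℝ)

/-- The price of anarchy of a measure `μ` in the swap game under `U`: the largest value of `μ` over
all assignments divided by the smallest value of `μ` over the equilibrium assignments. (There are
finitely many assignments of a finite set of agents, so both values are attained as soon as an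
equilibrium exists.) -/
noncomputable def priceOfAnarchy {X : Type u} {V : Type v} (μ : Assignment X V → ℝ)
    (U : Utility X V) : ℝ :=
  sSup (Set.range μ) / sInf (μ '' equilibria U)

/-- The partition of the agents into `t` types is equitable: with `k = ⌊n / t⌋`, where `n` is the
number of agents, every type has either `k` or `k + 1` agents. -/
def IsEquitable {X : Type u} [Fintype X] {t : ℕ} (type : X → Fin t) : Prop :=
  ∀ i : Fin t, Nat.card {A : X // type A = i} = Fintype.card X / t ∨
    Nat.card {A : X // type A = i} = Fintype.card X / t + 1

/-- The `m × m` torus, on `m * m` vertices: the Cartesian product of two cycles of length `m`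
(a 4-regular graph for `m ≥ 3`). -/
abbrev torus (m : ℕ) : SimpleGraph (Fin m × Fin m) :=
  (SimpleGraph.cycleGraph m) □ (SimpleGraph.cycleGraph m)

/-- `U_#` on the `m × m` torus. -/
noncomputable abbrev torusU {X : Type u} [Fintype X] {t : ℕ} (m : ℕ) (type : X → Fin t) :
    Utility X (Fin m × Fin m) :=
  differenceSeeking (torus m) type

/-- The price of anarchy of social welfare for the swap game under `U_#` on the `m × m` torus. -/
noncomputable abbrev torusPoA {X : Type u} [Fintype X] {t : ℕ} (m : ℕ) (type : X → Fin t) : ℝ :=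
  priceOfAnarchy (socialWelfare (torusU m type)) (torusU m type)

/-- The data of one game on the torus: `m ≥ 3`, the `m * m` vertices are occupied by `t * k` agents,
and the types are equitable. -/
def IsTorusGame {X : Type u} [Fintype X] {t : ℕ} (m k : ℕ) (type : X → Fin t) : Prop :=
  3 ≤ m ∧ m * m = t * k ∧ Fintype.card X = t * k ∧ IsEquitable type

end DiversitySwap

namespace DiversitySwap

/-! On a 4-regular graph an agent's utility is four minus the number of its neighbours of its own
type. Hence only the colouring of the vertices by types matters, and the welfare is 4n minus
`monoCount`. Write s(v) for the number of neighbours of v in its own colour. Stability says that,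
for v and w of different colours, w has at least s(v) neighbours of v's colour or vice versa, with
one more required when v and w are adjacent.

Bounds on every equilibrium come from playing this condition against degree four. A vertex with s ≥
3 forces s ≤ 1 on all other colours, and if there is no such vertex then at most three colours
contain a vertex with s = 2; both cases give `monoCount` ≤ (t+3)k (`IsStable.monoCount_le`).
Comparing all vertices with one maximiser of s gives 12k (`IsStable.monoCount_le_twelve`). For two
colours, counting the bichromatic edges at vertices with s = 2 gives 16k/5
(`IsStable.monoCount_le_of_two`). Dividing the trivial optimum bound 4tk by the resulting welfare
bounds yields the upper bounds on the price of anarchy.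

Lower bounds need a near-optimal colouring and a bad stable one. Numbering a strip of the torus row
by row and colouring by residues is proper as long as the modulus does not divide the width; this
gives welfare 4n - O(m) (`exists_dispersed`). With one colour gathered in the complement of such a
strip the colouring is still stable and loses about 4k (`exists_stable_clustered`). For two types an
explicit periodic pattern attains the bound 16k/5, and exceptional blocks of length 12 adapt it to
every even side (`exists_stable_pattern`). -/

open Classical in
/-- The indicator of adjacency. -/
noncomputable def adjInd {V : Type*} (G : SimpleGraph V) (v w : V) : ℕ := if G.Adj v w then 1 else 0

lemma adjInd_comm {V : Type*} (G : SimpleGraph V) (v w : V) : adjInd G v w = adjInd G w v := by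
  by_cases h : G.Adj v w
  · simp [adjInd, h, h.symm]
  · have h' : ¬ G.Adj w v := fun e => h e.symm
    simp [adjInd, h, h']

/-! ### Colourings of 4-regular graphs and their monochromatic edges -/

section Colouring

variable {V : Type*} {T : Type*} [Fintype V]

open Classical in
/-- The number of neighbours of `v` of colour `c` under the colouring `f`. -/
noncomputable def typeCount (G : SimpleGraph V) (f : V → T) (v : V) (c : T) : ℕ :=
  ∑ w : V, if G.Adj v w ∧ f w = c then 1 else 0

/-- The number of ordered pairs of adjacent vertices of the same colour. -/
noncomputable def monoCount (G : SimpleGraph V) (f : V → T) : ℕ := ∑ v, typeCount G f v (f v)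

open Classical in
/-- Every vertex has exactly four neighbours. -/
def FourRegular (G : SimpleGraph V) : Prop := ∀ v, (∑ w : V, if G.Adj v w then 1 else 0) = 4

/-- The colouring form of the equilibrium condition for `U_#` on a 4-regular graph. -/
def IsStable (G : SimpleGraph V) (f : V → T) : Prop :=
  ∀ v w, f v ≠ f w → typeCount G f v (f v) + adjInd G v w ≤ typeCount G f w (f v) ∨
    typeCount G f w (f w) + adjInd G v w ≤ typeCount G f v (f w)

open Classical in
lemma typeCount_eq_sum_adjInd (G : SimpleGraph V) (f : V → T) (v : V) (c : T) :
    typeCount G f v c = ∑ w, if f w = c then adjInd G v w else 0 := by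
  unfold typeCount adjInd
  refine Finset.sum_congr rfl fun w _ => ?_
  by_cases h1 : G.Adj v w <;> by_cases h2 : f w = c <;> simp [h1, h2]

lemma FourRegular.sum_adjInd {G : SimpleGraph V} (hG : FourRegular G) (v : V) :
    ∑ w, adjInd G v w = 4 := hG v

lemma sum_typeCount [Fintype T] {G : SimpleGraph V} (hG : FourRegular G) (f : V → T) (v : V) :
    ∑ c, typeCount G f v c = 4 := by
  classical
  rw [← hG.sum_adjInd v]
  simp only [typeCount_eq_sum_adjInd]
  rw [Finset.sum_comm]
  simp

lemma typeCount_le {G : SimpleGraph V} (hG : FourRegular G) (f : V → T) (v : V) (c : T) :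
    typeCount G f v c ≤ 4 := by
  classical
  rw [← hG.sum_adjInd v, typeCount_eq_sum_adjInd]
  refine Finset.sum_le_sum fun w _ => ?_
  split_ifs <;> simp

open Classical in
lemma adjInd_le_typeCount (G : SimpleGraph V) (f : V → T) (v w : V) :
    adjInd G v w ≤ typeCount G f v (f w) := by
  rw [typeCount_eq_sum_adjInd]
  refine le_trans ?_ (Finset.single_le_sum (f := fun x => if f x = f w then adjInd G v x else 0)
    (fun _ _ => Nat.zero_le _) (Finset.mem_univ w))
  simp

open Classical in
lemma sum_adjInd_comm (G : SimpleGraph V) (P Q : V → Prop) :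
    (∑ v, if P v then ∑ w, (if Q w then adjInd G v w else 0) else 0) =
      ∑ w, if Q w then ∑ v, (if P v then adjInd G w v else 0) else 0 := by
  have h : ∀ (P Q : V → Prop), (∑ v, if P v then ∑ w, (if Q w then adjInd G v w else 0) else 0) =
      ∑ v, ∑ w, if P v ∧ Q w then adjInd G v w else 0 := by
    intro P Q
    refine Finset.sum_congr rfl fun v _ => ?_
    by_cases hv : P v <;> simp [hv]
  rw [h, h, Finset.sum_comm]
  refine Finset.sum_congr rfl fun v _ => Finset.sum_congr rfl fun w _ => ?_
  simp only [and_comm, adjInd_comm G w v]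

open Classical in
/-- Every vertex of colour `c` is seen by its four neighbours. -/
lemma sum_typeCount_colour {G : SimpleGraph V} (hG : FourRegular G) (f : V → T) (c : T) :
    ∑ v, typeCount G f v c = 4 * Finset.card {v | f v = c} := by
  have := sum_adjInd_comm G (fun _ => True) (fun w => f w = c)
  simp only [if_true] at this
  simp only [typeCount_eq_sum_adjInd, this, hG.sum_adjInd]
  rw [← Finset.sum_filter]
  simp [mul_comm]

-- After the swap v carries the colour of w, so w no longer sees the colour of v there. This loss is
-- the adjacency term in `IsStable`.
open Classical in
lemma typeCount_swap (G : SimpleGraph V) (f : V → T) {v w : V} (h : f v ≠ f w) :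
    typeCount G (f ∘ Equiv.swap v w) w (f v) + adjInd G v w = typeCount G f w (f v) := by
  simp only [typeCount_eq_sum_adjInd]
  rw [← Finset.add_sum_erase _ _ (Finset.mem_univ v),
    ← Finset.add_sum_erase (a := v) Finset.univ
      (fun x => if f x = f v then adjInd G w x else 0) (Finset.mem_univ v)]
  have : ∀ x ∈ Finset.univ.erase v,
      (if (f ∘ Equiv.swap v w) x = f v then adjInd G w x else 0) =
      (if f x = f v then adjInd G w x else 0) := by
    intro x hx
    have hxv : x ≠ v := Finset.ne_of_mem_erase hx
    by_cases hxw : x = w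
    · subst hxw; simp [adjInd]
    · simp [Equiv.swap_apply_of_ne_of_ne hxv hxw]
  rw [Finset.sum_congr rfl this]
  simp [h.symm, adjInd_comm G v w]
  ring

/-! ### Recolouring one vertex -/

-- Isolates the dependence on the colour of v: pairs avoiding v do not involve it, and each
-- monochromatic edge at v is counted once from either end.
open Classical in
lemma monoCount_eq (G : SimpleGraph V) (f : V → T) (v : V) :
    monoCount G f = (∑ x ∈ Finset.univ.erase v, ∑ y ∈ Finset.univ.erase v,
      if f y = f x then adjInd G x y else 0) + 2 * typeCount G f v (f v) := by
  have hvv : adjInd G v v = 0 := by simp [adjInd]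
  unfold monoCount
  simp only [typeCount_eq_sum_adjInd]
  rw [← Finset.add_sum_erase _ _ (Finset.mem_univ v)]
  have h1 : ∀ x, (∑ y, if f y = f x then adjInd G x y else 0) =
      (if f v = f x then adjInd G x v else 0) +
        ∑ y ∈ Finset.univ.erase v, if f y = f x then adjInd G x y else 0 := fun x =>
    (Finset.add_sum_erase Finset.univ (fun y => if f y = f x then adjInd G x y else 0)
      (Finset.mem_univ v)).symm
  have h2 : (∑ x ∈ Finset.univ.erase v, if f v = f x then adjInd G x v else 0) =
      ∑ y, if f y = f v then adjInd G v y else 0 := by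
    rw [h1 v, hvv]
    simp only [if_true, zero_add]
    exact Finset.sum_congr rfl fun x _ => by simp only [adjInd_comm G x v, eq_comm]
  rw [Finset.sum_congr (s₁ := Finset.univ.erase v) rfl fun x _ => h1 x,
    Finset.sum_add_distrib, h2]
  ring

open Classical in
lemma typeCount_update (G : SimpleGraph V) (f : V → T) (v : V) (b c : T) :
    typeCount G (Function.update f v b) v c = typeCount G f v c := by
  simp only [typeCount_eq_sum_adjInd]
  refine Finset.sum_congr rfl fun x _ => ?_
  by_cases h : x = v
  · subst h; simp [adjInd]
  · simp [Function.update_of_ne h]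

open Classical in
lemma monoCount_update (G : SimpleGraph V) (f : V → T) (v : V) (b : T) :
    monoCount G (Function.update f v b) + 2 * typeCount G f v (f v) =
      monoCount G f + 2 * typeCount G f v b := by
  rw [monoCount_eq G f v, monoCount_eq G (Function.update f v b) v, typeCount_update]
  have : ∀ x ∈ Finset.univ.erase v, ∀ y ∈ Finset.univ.erase v,
      (if Function.update f v b y = Function.update f v b x then adjInd G x y else 0) =
        if f y = f x then adjInd G x y else 0 := by
    intro x hx y hy
    rw [Function.update_of_ne (Finset.ne_of_mem_erase hx),
      Function.update_of_ne (Finset.ne_of_mem_erase hy)]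
  rw [Finset.sum_congr rfl fun x hx => Finset.sum_congr rfl (this x hx)]
  simp only [Function.update_self]
  ring

open Classical in
lemma typeCount_update_of_ne (G : SimpleGraph V) (f : V → T) {v w : V} (b c : T) :
    typeCount G (Function.update f v b) w c + (if f v = c then adjInd G v w else 0) =
      typeCount G f w c + (if b = c then adjInd G v w else 0) := by
  simp only [typeCount_eq_sum_adjInd]
  rw [← Finset.add_sum_erase _ _ (Finset.mem_univ v),
    ← Finset.add_sum_erase (a := v) Finset.univ
      (fun x => if f x = c then adjInd G w x else 0) (Finset.mem_univ v)]
  have : ∀ x ∈ Finset.univ.erase v,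
      (if Function.update f v b x = c then adjInd G w x else 0) =
      (if f x = c then adjInd G w x else 0) := by
    intro x hx
    rw [Function.update_of_ne (Finset.ne_of_mem_erase hx)]
  rw [Finset.sum_congr rfl this]
  simp only [Function.update_self, adjInd_comm G v w]
  ring

open Classical in
/-- A swap of two vertices that violates stability destroys monochromatic edges. -/
lemma monoCount_swap_lt (G : SimpleGraph V) (f : V → T) {v w : V} (h : f v ≠ f w)
    (h1 : typeCount G f w (f v) < typeCount G f v (f v) + adjInd G v w)
    (h2 : typeCount G f v (f w) < typeCount G f w (f w) + adjInd G v w) :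
    monoCount G (f ∘ Equiv.swap v w) < monoCount G f := by
  have hne : v ≠ w := fun e => h (by rw [e])
  -- A swap is two successive recolourings; the second sees the effect of the first, whence the
  -- adjacency corrections `a3` and `a4`.
  have e : f ∘ Equiv.swap v w =
      Function.update (Function.update f v (f w)) w (f v) := by
    funext x
    by_cases hw : x = w
    · subst hw; simp
    by_cases hv : x = v
    · subst hv; simp [hne]
    · simp [Equiv.swap_apply_of_ne_of_ne hv hw, hw, hv]
  rw [e]
  have a1 := monoCount_update G f v (f w)
  have a2 := monoCount_update G (Function.update f v (f w)) w (f v)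
  have a3 := typeCount_update_of_ne G f (v := v) (w := w) (f w) (f v)
  have a4 := typeCount_update_of_ne G f (v := v) (w := w) (f w) (f w)
  rw [Function.update_of_ne hne.symm] at a2
  simp only [if_true, if_neg h, if_neg h.symm] at a3 a4
  omega

end Colouring

/-! ### From assignments to colourings -/

section Game

variable {X : Type*} {V : Type*} {T : Type*} [Fintype X] [Fintype V]

lemma differenceSeeking_add {G : SimpleGraph V} (hG : FourRegular G) (type : X → T)
    (L : Assignment X V) (A : X) :
    differenceSeeking G type L A + (typeCount G (type ∘ L.symm) (L A) (type A) : ℝ) = 4 := by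
  classical
  unfold differenceSeeking
  have h : (∑ w, ((if G.Adj (L A) w ∧ type (L.symm w) ≠ type A then 1 else 0) +
      (if G.Adj (L A) w ∧ type (L.symm w) = type A then 1 else 0) : ℕ)) = 4 := by
    rw [← hG (L A)]
    refine Finset.sum_congr rfl fun w _ => ?_
    by_cases h1 : G.Adj (L A) w <;> by_cases h2 : type (L.symm w) = type A <;> simp [h1, h2]
  rw [Finset.sum_add_distrib] at h
  have h2 : (Finset.univ.filter fun B => G.Adj (L A) (L B) ∧ type B ≠ type A).card =
      ∑ w, if G.Adj (L A) w ∧ type (L.symm w) ≠ type A then 1 else 0 := by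
    rw [Finset.card_filter, ← Equiv.sum_comp L]
    simp
  have h3 : typeCount G (type ∘ L.symm) (L A) (type A) =
      ∑ w, if G.Adj (L A) w ∧ type (L.symm w) = type A then 1 else 0 := by
    unfold typeCount
    exact Finset.sum_congr rfl fun w _ => by congr
  rw [h3]
  have h4 : (Finset.univ.filter fun B => G.Adj (L A) (L B) ∧ type B ≠ type A).card +
      (∑ w, if G.Adj (L A) w ∧ type (L.symm w) = type A then 1 else 0) = 4 := by
    rw [h2]; exact h
  convert congrArg (Nat.cast (R := ℝ)) h4 using 1
  · push_cast
    congr 3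
  · norm_num

lemma socialWelfare_add {G : SimpleGraph V} (hG : FourRegular G) (type : X → T)
    (L : Assignment X V) :
    socialWelfare (differenceSeeking G type) L + (monoCount G (type ∘ L.symm) : ℝ) =
      4 * Fintype.card X := by
  have : ∀ A, differenceSeeking G type L A +
      (typeCount G (type ∘ L.symm) (L A) (type A) : ℝ) = 4 := differenceSeeking_add hG type L
  have h := Finset.sum_congr (s₁ := Finset.univ) rfl fun A _ => this A
  rw [Finset.sum_add_distrib] at h
  unfold socialWelfare monoCount
  rw [← Equiv.sum_comp L]
  push_cast
  simp only [Function.comp_apply, Equiv.symm_apply_apply]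
  rw [h]
  simp [mul_comm]

/-- Swapping agents composes the colouring with a transposition of vertices, so for different types
`typeCount_swap` translates strict improvement into the negation of the stability inequalities. -/
lemma mem_equilibria_iff {G : SimpleGraph V} (hG : FourRegular G) (type : X → T)
    (L : Assignment X V) :
    L ∈ equilibria (differenceSeeking G type) ↔ IsStable G (type ∘ L.symm) := by
  classical
  set f := type ∘ L.symm with hf
  have hsw : ∀ A B, type ∘ (swapLocations L A B).symm = f ∘ Equiv.swap (L A) (L B) := by
    intro A B
    funext v
    simp only [hf, swapLocations, Function.comp_apply, Equiv.symm_trans_apply]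
    congr 1
    have := Equiv.symm_swap A B
    rw [this]
    obtain ⟨z, rfl⟩ := L.surjective v
    rw [L.injective.swap_apply, L.symm_apply_apply, L.symm_apply_apply]
  have hA : ∀ A B, swapLocations L A B A = L B := by intro A B; simp [swapLocations]
  have hB : ∀ A B, swapLocations L A B B = L A := by intro A B; simp [swapLocations]
  have hfL : ∀ A, f (L A) = type A := by intro A; simp [hf]
  have key : ∀ A B, type A ≠ type B → (IsMove (differenceSeeking G type) L A B ↔
      typeCount G f (L B) (f (L A)) < typeCount G f (L A) (f (L A)) + adjInd G (L A) (L B) ∧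
      typeCount G f (L A) (f (L B)) < typeCount G f (L B) (f (L B)) + adjInd G (L A) (L B)) := by
    intro A B hAB
    have u1 := differenceSeeking_add hG type L A
    have u2 := differenceSeeking_add hG type L B
    have u3 := differenceSeeking_add hG type (swapLocations L A B) A
    have u4 := differenceSeeking_add hG type (swapLocations L A B) B
    rw [hsw, hA] at u3
    rw [hsw, hB] at u4
    have hne : f (L A) ≠ f (L B) := by simpa [hfL] using hAB
    have s1 := typeCount_swap G f hne
    have s2 := typeCount_swap G f hne.symm
    rw [Equiv.swap_comm, adjInd_comm] at s2
    rw [← hfL A] at u1 u3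
    rw [← hfL B] at u2 u4
    rw [← s1, ← s2]
    unfold IsMove
    constructor
    · rintro ⟨m1, m2⟩
      constructor
      · have : (typeCount G (f ∘ Equiv.swap (L A) (L B)) (L B) (f (L A)) : ℝ) <
          typeCount G f (L A) (f (L A)) := by linarith
        have : typeCount G (f ∘ Equiv.swap (L A) (L B)) (L B) (f (L A))  <
          typeCount G f (L A) (f (L A)) := by exact_mod_cast this
        omega
      · have : (typeCount G (f ∘ Equiv.swap (L A) (L B)) (L A) (f (L B)) : ℝ) <
          typeCount G f (L B) (f (L B)) := by linarith
        have : typeCount G (f ∘ Equiv.swap (L A) (L B)) (L A) (f (L B))  <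
          typeCount G f (L B) (f (L B)) := by exact_mod_cast this
        omega
    · rintro ⟨m1, m2⟩
      have m1 : typeCount G (f ∘ Equiv.swap (L A) (L B)) (L B) (f (L A))  <
          typeCount G f (L A) (f (L A)) := by omega
      have m2 : typeCount G (f ∘ Equiv.swap (L A) (L B)) (L A) (f (L B))  <
          typeCount G f (L B) (f (L B)) := by omega
      have m1 : (typeCount G (f ∘ Equiv.swap (L A) (L B)) (L B) (f (L A)) : ℝ) <
          typeCount G f (L A) (f (L A)) := by exact_mod_cast m1
      have m2 : (typeCount G (f ∘ Equiv.swap (L A) (L B)) (L A) (f (L B)) : ℝ) <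
          typeCount G f (L B) (f (L B)) := by exact_mod_cast m2
      constructor <;> linarith
  constructor
  · intro hL v w hvw
    obtain ⟨A, rfl⟩ := L.surjective v
    obtain ⟨B, rfl⟩ := L.surjective w
    by_contra hcon
    push Not at hcon
    exact hL A B ((key A B (by simpa [hfL] using hvw)).2 hcon)
  · intro hS A B
    by_cases hAB : type A = type B
    -- For equal types the colouring does not change and the agents exchange utilities, so they
    -- cannot both gain.
    · rintro ⟨m1, m2⟩
      have u1 := differenceSeeking_add hG type L A
      have u2 := differenceSeeking_add hG type L B
      have u3 := differenceSeeking_add hG type (swapLocations L A B) A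
      have u4 := differenceSeeking_add hG type (swapLocations L A B) B
      have e : f ∘ Equiv.swap (L A) (L B) = f := by
        funext x
        by_cases h1 : x = L A
        · subst h1; simp [hfL, hAB]
        by_cases h2 : x = L B
        · subst h2; simp [hfL, hAB]
        · simp [Equiv.swap_apply_of_ne_of_ne h1 h2]
      rw [hsw, hA, e] at u3
      rw [hsw, hB, e] at u4
      rw [← hf] at u1 u2
      rw [hAB] at u1 u3
      linarith
    · rw [key A B hAB]
      have := hS (L A) (L B) (by simpa [hfL] using hAB)
      omega

/-- A welfare maximiser is an equilibrium. -/
lemma equilibria_nonempty {G : SimpleGraph V} (hG : FourRegular G) (type : X → T)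
    (hc : Fintype.card X = Fintype.card V) :
    (equilibria (differenceSeeking G type)).Nonempty := by
  classical
  have : Nonempty (Assignment X V) := ⟨Fintype.equivOfCardEq hc⟩
  obtain ⟨L, hL⟩ := Finite.exists_min fun L : Assignment X V => monoCount G (type ∘ L.symm)
  refine ⟨L, (mem_equilibria_iff hG type L).2 fun v w hvw => ?_⟩
  by_contra hcon
  push Not at hcon
  have h1 := monoCount_swap_lt G _ hvw hcon.1 hcon.2
  have h2 := hL (L.trans (Equiv.swap v w))
  have e : type ∘ (L.trans (Equiv.swap v w)).symm = (type ∘ L.symm) ∘ Equiv.swap v w := by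
    funext x; simp
  rw [e] at h2
  omega

open Classical in
/-- A colouring with the same class sizes as the types comes from an assignment. -/
lemma exists_assignment (type : X → T) (f : V → T)
    (h : ∀ c, Fintype.card {A // type A = c} = Fintype.card {v // f v = c}) :
    ∃ L : Assignment X V, type ∘ L.symm = f := by
  let e := fun c => Fintype.equivOfCardEq (h c)
  refine ⟨(Equiv.sigmaFiberEquiv type).symm.trans
    ((Equiv.sigmaCongrRight e).trans (Equiv.sigmaFiberEquiv f)), ?_⟩
  funext v
  simp only [Function.comp_apply, Equiv.symm_trans_apply, Equiv.symm_symm]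
  obtain ⟨⟨c, x⟩, rfl⟩ := (Equiv.sigmaFiberEquiv f).surjective v
  simp only [Equiv.sigmaFiberEquiv, Equiv.coe_fn_mk, Equiv.coe_fn_symm_mk,
    Equiv.sigmaCongrRight]
  exact ((e (f x)).symm ⟨x, _⟩).2

end Game

/-! ### Upper bounds on monochromatic edges in stable colourings -/

section Bounds

variable {V : Type*} {T : Type*} [Fintype V]

open Classical in
/-- Every colour is used exactly `k` times. -/
def IsBalanced (f : V → T) (k : ℕ) : Prop := ∀ c, Finset.card {v | f v = c} = k

lemma isBalanced_iff [DecidableEq T] {f : V → T} {k : ℕ} :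
    IsBalanced f k ↔ ∀ c, Finset.card {v | f v = c} = k := by
  unfold IsBalanced
  congr!

lemma IsBalanced.sum_comp [Fintype T] {f : V → T} {k : ℕ} (hf : IsBalanced f k) (g : T → ℕ) :
    ∑ v, g (f v) = k * ∑ c, g c := by
  classical
  rw [← Finset.sum_fiberwise Finset.univ f (fun v => g (f v)), Finset.mul_sum]
  refine Finset.sum_congr rfl fun c _ => ?_
  rw [Finset.sum_congr rfl (g := fun _ => g c)
    (fun v hv => by rw [(Finset.mem_filter.1 hv).2])]
  rw [Finset.sum_const, smul_eq_mul, ← hf c]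

lemma typeCount_add_le [Fintype T] {G : SimpleGraph V} (hG : FourRegular G) (f : V → T) (v : V)
    {a b : T} (hab : a ≠ b) : typeCount G f v a + typeCount G f v b ≤ 4 := by
  classical
  rw [← sum_typeCount hG f v, ← Finset.sum_pair (f := fun c => typeCount G f v c) hab]
  exact Finset.sum_le_sum_of_subset (Finset.subset_univ _)

/-- Opposite a vertex with at least three neighbours of its own colour, every vertex has at most
one neighbour of its own colour. -/
lemma IsStable.typeCount_le_one [Fintype T] {G : SimpleGraph V} (hG : FourRegular G) {f : V → T}
    (hS : IsStable G f) {v w : V} (hv : 3 ≤ typeCount G f v (f v)) (h : f v ≠ f w) :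
    typeCount G f w (f w) ≤ 1 := by
  have h1 := typeCount_add_le hG f w h
  have h2 := typeCount_add_le hG f v h
  rcases hS v w h with h3 | h3 <;> omega

-- All vertices are compared with a vertex v maximising s, with j = s(v). The total is at most 4k
-- for the class of v, 4k for edges into that class, and k·j(4 - j) ≤ 4k for the colours next to v.
open Classical in
lemma IsStable.monoCount_le_twelve [Fintype T] {G : SimpleGraph V} (hG : FourRegular G) {f : V → T}
    {k : ℕ} (hf : IsBalanced f k) (hS : IsStable G f) : monoCount G f ≤ 12 * k := by
  rcases isEmpty_or_nonempty V with hV | hV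
  · simp [monoCount]
  obtain ⟨v, hv⟩ := Finite.exists_max fun v => typeCount G f v (f v)
  set j := typeCount G f v (f v) with hj
  -- If v sees no vertex of the colour of w, stability gives s(w) = 0 or j ≤ the number of
  -- neighbours of w in the colour of v; otherwise s(w) ≤ j is charged to the neighbours of v in
  -- that colour.
  have hpt : ∀ w, typeCount G f w (f w) ≤ (if f w = f v then 4 else 0) +
      (j * if f w = f v then 0 else typeCount G f v (f w)) + typeCount G f w (f v) := by
    intro w
    by_cases h : f w = f v
    · have := typeCount_le hG f w (f w)
      simp only [h, if_true] at this ⊢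
      omega
    · simp only [if_neg h]
      rcases Nat.eq_zero_or_pos (typeCount G f v (f w)) with h0 | h0
      · rcases hS v w (Ne.symm h) with h3 | h3
        · have := hv w
          omega
        · omega
      · have := hv w
        have := Nat.le_mul_of_pos_right j h0
        omega
  have hsum := Finset.sum_le_sum fun w (_ : w ∈ Finset.univ) => hpt w
  rw [Finset.sum_add_distrib, Finset.sum_add_distrib,
    hf.sum_comp (fun c => if c = f v then 4 else 0), ← Finset.mul_sum,
    hf.sum_comp (fun c => if c = f v then 0 else typeCount G f v c),
    sum_typeCount_colour hG, hf (f v)] at hsum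
  have h4 := sum_typeCount hG f v
  rw [← Finset.add_sum_erase _ _ (Finset.mem_univ (f v))] at h4
  have h5 : (∑ c, if c = f v then 0 else typeCount G f v c) =
      ∑ c ∈ Finset.univ.erase (f v), typeCount G f v c := by
    rw [← Finset.add_sum_erase _ _ (Finset.mem_univ (f v))]
    simp only [if_true, zero_add]
    exact Finset.sum_congr rfl fun c hc => if_neg (Finset.ne_of_mem_erase hc)
  rw [h5] at hsum
  simp only [Finset.sum_ite_eq', Finset.mem_univ, if_true] at hsum
  change ∑ w, typeCount G f w (f w) ≤ _
  refine hsum.trans ?_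
  rw [← hj] at h4
  generalize (∑ c ∈ Finset.univ.erase (f v), typeCount G f v c) = x at *
  have : j * x ≤ 4 := by
    have : j ≤ 4 := by omega
    have hx : x = 4 - j := by omega
    subst hx
    interval_cases j <;> norm_num
  nlinarith

-- It suffices to bound s on each colour class so that the bounds add up to t + 3: either one class
-- gets 4 and the others 1, or at most three classes get 2 and the others 1.
open Classical in
lemma IsStable.monoCount_le [Fintype T] {G : SimpleGraph V} (hG : FourRegular G) {f : V → T}
    {k : ℕ} (hf : IsBalanced f k) (hS : IsStable G f) :
    monoCount G f ≤ (Fintype.card T + 3) * k := by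
  suffices h : ∃ g : T → ℕ, (∀ w, typeCount G f w (f w) ≤ g (f w)) ∧
      ∑ c, g c ≤ Fintype.card T + 3 by
    obtain ⟨g, h1, h2⟩ := h
    calc monoCount G f ≤ ∑ w, g (f w) := Finset.sum_le_sum fun w _ => h1 w
      _ = k * ∑ c, g c := hf.sum_comp g
      _ ≤ _ := by rw [mul_comm]; exact Nat.mul_le_mul_right _ h2
  by_cases hbig : ∃ v, 3 ≤ typeCount G f v (f v)
  · obtain ⟨v, hv⟩ := hbig
    refine ⟨fun c => 1 + if c = f v then 3 else 0, fun w => ?_, ?_⟩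
    · by_cases h : f w = f v
      · simp only [h, if_true]
        exact typeCount_le hG f w (f v)
      · simp only [if_neg h]
        exact hS.typeCount_le_one hG hv (Ne.symm h)
    · simp [Finset.sum_add_distrib]
  push Not at hbig
  set D : Finset T := {c | ∃ v, f v = c ∧ typeCount G f v (f v) = 2} with hD
  refine ⟨fun c => 1 + if c ∈ D then 1 else 0, fun w => ?_, ?_⟩
  · have := hbig w
    by_cases h : f w ∈ D
    · simp only [h, if_true]; omega
    · simp only [h, if_false]
      have h2 : typeCount G f w (f w) ≠ 2 := fun e => h (by simp [hD]; exact ⟨w, rfl, e⟩)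
      omega
  have hcard : D.card ≤ 3 := by
    -- Stability makes R a relation comparing any two colours of D, and degree four allows
    -- out-degree at most one, since 2 + 2 + 2 > 4. Hence |D|(|D| - 1) ≤ 2|D|.
    let R : T → T → Prop := fun a b => ∀ v, f v = a → typeCount G f v a = 2 →
      2 ≤ typeCount G f v b
    have hR : ∀ a b, a ≠ b → R a b ∨ R b a := by
      intro a b hab
      by_contra hcon
      simp only [R, not_or, not_forall, not_le] at hcon
      obtain ⟨⟨v, rfl, hv, hvb⟩, ⟨w, rfl, hw, hwa⟩⟩ := hcon
      rcases hS v w hab with h | h <;> omega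
    have huniq : ∀ a ∈ D, ∀ b c, a ≠ b → a ≠ c → R a b → R a c → b = c := by
      intro a ha b c hab hac h1 h2
      by_contra hbc
      obtain ⟨v, rfl, hv⟩ := (Finset.mem_filter.1 ha).2
      have h1 := h1 v rfl hv
      have h2 := h2 v rfl hv
      have h3 : ∑ x ∈ {f v, b, c}, typeCount G f v x ≤ 4 := by
        rw [← sum_typeCount hG f v]
        exact Finset.sum_le_sum_of_subset (Finset.subset_univ _)
      rw [Finset.sum_insert (by simp [hab, hac]), Finset.sum_pair hbc] at h3
      omega
    have hsub : D.offDiag ⊆ (D.offDiag.filter fun p => R p.1 p.2) ∪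
        (D.offDiag.filter fun p => R p.2 p.1) := by
      intro p hp
      have := hR p.1 p.2 (Finset.mem_offDiag.1 hp).2.2
      simp only [Finset.mem_union, Finset.mem_filter]
      tauto
    have h1 : (D.offDiag.filter fun p => R p.1 p.2).card ≤ D.card := by
      refine Finset.card_le_card_of_injOn Prod.fst (fun p hp => ?_) ?_
      · exact (Finset.mem_offDiag.1 (Finset.mem_filter.1 hp).1).1
      · rintro ⟨a, b⟩ hp ⟨a', c⟩ hq (rfl : a = a')
        simp only [Finset.coe_filter, Set.mem_ofPred_eq, Finset.mem_offDiag] at hp hq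
        rw [huniq a hp.1.1 b c hp.1.2.2 hq.1.2.2 hp.2 hq.2]
    have h2 : (D.offDiag.filter fun p => R p.2 p.1).card ≤ D.card := by
      refine Finset.card_le_card_of_injOn Prod.snd (fun p hp => ?_) ?_
      · exact (Finset.mem_offDiag.1 (Finset.mem_filter.1 hp).1).2.1
      · rintro ⟨b, a⟩ hp ⟨c, a'⟩ hq (rfl : a = a')
        simp only [Finset.coe_filter, Set.mem_ofPred_eq, Finset.mem_offDiag] at hp hq
        rw [huniq a hp.1.2.1 b c hp.1.2.2.symm hq.1.2.2.symm hp.2 hq.2]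
    have h3 := (Finset.card_le_card hsub).trans (Finset.card_union_le _ _)
    rw [Finset.offDiag_card] at h3
    by_contra h4
    have : D.card * D.card ≥ 4 * D.card := Nat.mul_le_mul_right _ (by omega)
    omega
  simp only [Finset.sum_add_distrib, Finset.sum_const, Finset.card_univ, smul_eq_mul, mul_one,
    Finset.sum_ite_mem, Finset.univ_inter]
  omega

-- If all s ≤ 2, a vertex with s = 2 has its two neighbours of the other colour among the vertices
-- with s ≤ 1. Balancing these edges puts at most 3/5 of the vertices at s = 2, and the average of s
-- is at most 8/5.
open Classical in
lemma IsStable.monoCount_le_of_two {G : SimpleGraph V} (hG : FourRegular G) {f : V → Fin 2}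
    {k : ℕ} (hf : IsBalanced f k) (hS : IsStable G f) : 5 * monoCount G f ≤ 16 * k := by
  have htwo : ∀ a b c : Fin 2, a ≠ b → (c ≠ a ↔ c = b) := by decide
  by_cases hbig : ∃ v, 3 ≤ typeCount G f v (f v)
  -- Both classes have total degree 4k and send equally many edges to each other, so their
  -- monochromatic counts agree. The class opposite v contributes at most k, hence the total is at
  -- most 2k.
  · obtain ⟨v, hv⟩ := hbig
    obtain ⟨b, hb⟩ : ∃ b, f v ≠ b := ⟨f v + 1, by generalize f v = c; revert c; decide⟩
    have hcol : ∀ c d : Fin 2, c ≠ d → (∑ w, if f w = c then typeCount G f w (f w) else 0) +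
        (∑ w, if f w = c then typeCount G f w d else 0) = 4 * k := by
      intro c d hcd
      rw [← Finset.sum_add_distrib, ← hf c, Finset.card_filter, Finset.mul_sum]
      refine Finset.sum_congr rfl fun w _ => ?_
      split_ifs with h
      · have h4 := sum_typeCount hG f w
        have huniv : (Finset.univ : Finset (Fin 2)) = {c, d} := by
          ext x; have := htwo c d x hcd; simp; tauto
        rw [huniv, Finset.sum_pair hcd] at h4
        rw [h]; omega
      · simp
    have hdc := sum_adjInd_comm G (fun w => f w = f v) (fun w => f w = b)
    simp only [← typeCount_eq_sum_adjInd] at hdc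
    have e1 := hcol _ _ hb
    have e2 := hcol _ _ hb.symm
    have hle : (∑ w, if f w = b then typeCount G f w (f w) else 0) ≤ k := by
      rw [← hf b, Finset.card_filter]
      refine Finset.sum_le_sum fun w _ => ?_
      split_ifs with h
      · exact hS.typeCount_le_one hG hv (h ▸ hb)
      · exact le_rfl
    have hm : monoCount G f = (∑ w, if f w = f v then typeCount G f w (f w) else 0) +
        (∑ w, if f w = b then typeCount G f w (f w) else 0) := by
      rw [← Finset.sum_add_distrib]
      refine Finset.sum_congr rfl fun w _ => ?_
      by_cases h : f w = f v
      · have : f w ≠ b := h ▸ hb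
        simp [h, hb]
      · have : f w = b := (htwo _ _ _ hb).1 h
        simp [this, hb.symm]
    omega
  push Not at hbig
  have hopp : ∀ v, (∑ w, if f w ≠ f v then adjInd G v w else 0) + typeCount G f v (f v) = 4 := by
    intro v
    rw [typeCount_eq_sum_adjInd, ← Finset.sum_add_distrib, ← hG.sum_adjInd v]
    refine Finset.sum_congr rfl fun w _ => ?_
    by_cases h : f w = f v <;> simp [h]
  have hsep : ∀ v w, f w ≠ f v → adjInd G v w ≠ 0 → typeCount G f v (f v) = 2 →
      typeCount G f w (f w) ≤ 1 := by
    intro v w h ha hv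
    have h1 := typeCount_add_le hG f w h
    have h2 := typeCount_add_le hG f v h
    rcases hS v w h.symm with h3 | h3 <;> omega
  have hdc : (∑ v, if typeCount G f v (f v) = 2 then
        ∑ w, (if f w ≠ f v then adjInd G v w else 0) else 0) ≤
      ∑ w, if typeCount G f w (f w) ≤ 1 then
        ∑ v, (if f v ≠ f w then adjInd G w v else 0) else 0 := by
    calc _ = ∑ v, ∑ w, if typeCount G f v (f v) = 2 then
              (if f w ≠ f v then adjInd G v w else 0) else 0 :=
            Finset.sum_congr rfl fun v _ => by split_ifs <;> simp
      _ = ∑ w, ∑ v, if typeCount G f v (f v) = 2 then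
              (if f w ≠ f v then adjInd G v w else 0) else 0 := Finset.sum_comm
      _ ≤ ∑ w, ∑ v, if typeCount G f w (f w) ≤ 1 then
              (if f v ≠ f w then adjInd G w v else 0) else 0 := by
            refine Finset.sum_le_sum fun w _ => Finset.sum_le_sum fun v _ => ?_
            by_cases h0 : adjInd G v w = 0
            · simp [h0]
            by_cases h1 : f w ≠ f v
            · by_cases h2 : typeCount G f v (f v) = 2
              · rw [if_pos h2, if_pos h1, if_pos (hsep v w h1 h0 h2), if_pos h1.symm, adjInd_comm]
              · simp [h2]
            · simp [h1]
      _ = _ := Finset.sum_congr rfl fun w _ => by split_ifs <;> simp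
  have hn : ∑ _v : V, 8 = 16 * k := by
    have := hf.sum_comp (fun _ => 8)
    simp only [this]
    simp; ring
  rw [← hn, monoCount, Finset.mul_sum]
  -- Discharging: equality holds for s = 2 (10 = 8 + 2) and s = 1 (5 + 3 = 8), with slack at s = 0.
  -- Summation against `hdc` cancels the edge terms.
  have hpt : ∀ v, 5 * typeCount G f v (f v) + (if typeCount G f v (f v) ≤ 1 then
      ∑ w, (if f w ≠ f v then adjInd G v w else 0) else 0) ≤
      8 + if typeCount G f v (f v) = 2 then
        ∑ w, (if f w ≠ f v then adjInd G v w else 0) else 0 := by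
    intro v
    have h1 := hopp v
    have h2 := hbig v
    split_ifs <;> omega
  have := Finset.sum_le_sum fun v (_ : v ∈ Finset.univ) => hpt v
  rw [Finset.sum_add_distrib, Finset.sum_add_distrib] at this
  omega

end Bounds

/-! ### Neighbourhoods in the torus -/

section Torus

variable {m : ℕ}

lemma cycleGraph_adj_iff [NeZero m] (hm : 3 ≤ m) (a b : Fin m) :
    (SimpleGraph.cycleGraph m).Adj a b ↔ b = a + 1 ∨ b = a - 1 := by
  obtain ⟨n, rfl⟩ : ∃ n, m = n + 2 := ⟨m - 2, by omega⟩
  rw [SimpleGraph.cycleGraph_adj, sub_eq_iff_eq_add, sub_eq_iff_eq_add, eq_sub_iff_add_eq,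
    add_comm 1 b, add_comm 1 a, or_comm, eq_comm (a := a)]

lemma fin_add_one_val [NeZero m] (hm : 3 ≤ m) (a : Fin m) :
    ((a + 1 : Fin m) : ℕ) = if (a : ℕ) + 1 = m then 0 else (a : ℕ) + 1 := by
  obtain ⟨n, rfl⟩ : ∃ n, m = n + 1 := ⟨m - 1, by omega⟩
  rw [Fin.val_add_one]
  have := a.2
  simp only [Fin.ext_iff, Fin.val_last]
  split_ifs <;> omega

lemma fin_add_one_ne_sub_one [NeZero m] (hm : 3 ≤ m) (a : Fin m) : a + 1 ≠ a - 1 := by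
  intro h
  have h1 := fin_add_one_val hm (a + 1)
  have h0 := fin_add_one_val hm a
  rw [show a + 1 + 1 = a from eq_sub_iff_add_eq.1 h] at h1
  have := a.2
  split_ifs at h0 h1 <;> omega

lemma fin_add_one_ne [NeZero m] (hm : 3 ≤ m) (a : Fin m) : a + 1 ≠ a := by
  intro h
  have h0 := fin_add_one_val hm a
  rw [h] at h0
  have := a.2
  split_ifs at h0 <;> omega

lemma fin_sub_one_ne [NeZero m] (hm : 3 ≤ m) (a : Fin m) : a - 1 ≠ a := fun h =>
  fin_add_one_ne hm a (sub_eq_iff_eq_add.1 h).symm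

lemma torus_adj_iff [NeZero m] (hm : 3 ≤ m) (v w : Fin m × Fin m) :
    (torus m).Adj v w ↔ w ∈ ({(v.1 + 1, v.2), (v.1 - 1, v.2), (v.1, v.2 + 1), (v.1, v.2 - 1)} :
      Finset (Fin m × Fin m)) := by
  obtain ⟨a, b⟩ := v
  obtain ⟨c, d⟩ := w
  rw [SimpleGraph.boxProd_adj, cycleGraph_adj_iff hm, cycleGraph_adj_iff hm]
  simp only [Finset.mem_insert, Finset.mem_singleton, Prod.mk.injEq]
  constructor
  · rintro (⟨h1 | h1, h2⟩ | ⟨h1 | h1, h2⟩) <;> simp [h1, h2]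
  · rintro (⟨h1, h2⟩ | ⟨h1, h2⟩ | ⟨h1, h2⟩ | ⟨h1, h2⟩) <;> simp [h1, h2]

open Classical in
lemma sum_torus_adj [NeZero m] (hm : 3 ≤ m) (v : Fin m × Fin m) (g : Fin m × Fin m → ℕ) :
    (∑ w, if (torus m).Adj v w then g w else 0) =
      g (v.1 + 1, v.2) + g (v.1 - 1, v.2) + g (v.1, v.2 + 1) + g (v.1, v.2 - 1) := by
  simp only [torus_adj_iff hm]
  have h1 := fin_add_one_ne hm
  have h2 := fin_sub_one_ne hm
  have h3 := fin_add_one_ne_sub_one hm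
  rw [Finset.sum_ite_mem, Finset.univ_inter, Finset.sum_insert, Finset.sum_insert,
    Finset.sum_insert, Finset.sum_singleton]
  · ring
  all_goals simp [h1, h2, h3, (h1 _).symm, (h2 _).symm]

lemma fourRegular_torus (hm : 3 ≤ m) : FourRegular (torus m) := by
  have : NeZero m := ⟨by omega⟩
  intro v
  rw [sum_torus_adj hm v (fun _ => 1)]

open Classical in
lemma typeCount_torus {T : Type*} [NeZero m] (hm : 3 ≤ m) (f : Fin m × Fin m → T)
    (v : Fin m × Fin m) (c : T) : typeCount (torus m) f v c =
      (if f (v.1 + 1, v.2) = c then 1 else 0) + (if f (v.1 - 1, v.2) = c then 1 else 0) +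
      (if f (v.1, v.2 + 1) = c then 1 else 0) + (if f (v.1, v.2 - 1) = c then 1 else 0) := by
  rw [← sum_torus_adj hm v (fun w => if f w = c then 1 else 0)]
  unfold typeCount
  refine Finset.sum_congr rfl fun w _ => ?_
  rw [ite_and]

/-- Adjacency in the cycle on `m` vertices, on natural numbers. -/
def CycAdj (m a b : ℕ) : Prop := a + 1 = b ∨ b + 1 = a ∨ (a = 0 ∧ b + 1 = m) ∨ (b = 0 ∧ a + 1 = m)

lemma cycAdj_of_adj (hm : 3 ≤ m) {a b : Fin m} (h : (SimpleGraph.cycleGraph m).Adj a b) :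
    CycAdj m a b := by
  have : NeZero m := ⟨by omega⟩
  unfold CycAdj
  rcases (cycleGraph_adj_iff hm a b).1 h with h | h
  · have := fin_add_one_val hm a
    rw [← h] at this
    split_ifs at this <;> omega
  · have := fin_add_one_val hm b
    rw [← eq_sub_iff_add_eq.1 h]
    split_ifs at this <;> omega

lemma torus_adj_val (hm : 3 ≤ m) {u v : Fin m × Fin m} (h : (torus m).Adj u v) :
    (CycAdj m u.1 v.1 ∧ (u.2 : ℕ) = v.2) ∨ (CycAdj m u.2 v.2 ∧ (u.1 : ℕ) = v.1) := by
  rw [SimpleGraph.boxProd_adj] at h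
  rcases h with ⟨h1, h2⟩ | ⟨h1, h2⟩
  · exact Or.inl ⟨cycAdj_of_adj hm h1, by rw [h2]⟩
  · exact Or.inr ⟨cycAdj_of_adj hm h1, by rw [h2]⟩

end Torus

/-! ### Row-by-row strips and their residue colourings -/

section Strip

variable {m : ℕ}

/-- The position of a vertex in the row-by-row enumeration of the first `w` columns. -/
def stripPos (w : ℕ) (v : Fin m × Fin m) : ℕ := v.2 * w + v.1

/-- The first `N` vertices in the row-by-row enumeration of the first `w` columns. -/
def InStrip (w N : ℕ) (v : Fin m × Fin m) : Prop := (v.1 : ℕ) < w ∧ stripPos w v < N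

/-- Neighbours in the strip differ in position by 1 or w, neither divisible by c. Wrap-around edges
do not occur because the last column and the last row lie outside the strip. -/
lemma InStrip.mod_ne (hm : 3 ≤ m) {w N c : ℕ} (hw : w + 1 ≤ m) (hN : N ≤ w * (m - 1))
    (hc : 2 ≤ c) (hcw : ¬ c ∣ w) {u v : Fin m × Fin m} (hu : InStrip w N u) (hv : InStrip w N v)
    (h : (torus m).Adj u v) : stripPos w u % c ≠ stripPos w v % c := by
  have hrow : ∀ x : Fin m × Fin m, InStrip w N x → (x.2 : ℕ) + 1 < m := by
    intro x hx
    have : (x.2 : ℕ) * w < (m - 1) * w := by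
      rw [mul_comm (m - 1)]
      have := hx.2
      unfold stripPos at this
      omega
    have := lt_of_mul_lt_mul_right this (Nat.zero_le _)
    omega
  have h1 : ∀ p, p % c ≠ (p + 1) % c := by
    intro p e
    have := (Nat.modEq_iff_dvd' (Nat.le_succ p)).1 e
    simp at this
    omega
  have h2 : ∀ p, p % c ≠ (p + w) % c := by
    intro p e
    have := (Nat.modEq_iff_dvd' (Nat.le_add_right p w)).1 e
    simp at this
    exact hcw this
  have hu2 := hrow u hu
  have hv2 := hrow v hv
  have hu1 := hu.1
  have hv1 := hv.1
  rcases torus_adj_val hm h with ⟨h | h | h | h, e⟩ | ⟨h | h | h | h, e⟩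
  · have : stripPos w v = stripPos w u + 1 := by unfold stripPos; rw [e]; omega
    rw [this]; exact h1 _
  · have : stripPos w u = stripPos w v + 1 := by unfold stripPos; rw [e]; omega
    rw [this]; exact (h1 _).symm
  · omega
  · omega
  · have : stripPos w v = stripPos w u + w := by unfold stripPos; rw [e, ← h]; ring
    rw [this]; exact h2 _
  · have : stripPos w u = stripPos w v + w := by unfold stripPos; rw [e, ← h]; ring
    rw [this]; exact (h2 _).symm
  · omega
  · omega

lemma stripPos_injOn {w : ℕ} {u v : Fin m × Fin m} (hu : (u.1 : ℕ) < w) (hv : (v.1 : ℕ) < w)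
    (h : stripPos w u = stripPos w v) : u = v := by
  unfold stripPos at h
  have h2 := congrArg (· / w) h
  have h1 := congrArg (· % w) h
  simp only [mul_comm _ w, Nat.mul_add_mod, Nat.mod_eq_of_lt hu, Nat.mod_eq_of_lt hv] at h1
  simp only [mul_comm _ w, Nat.mul_add_div (by omega : w > 0), Nat.div_eq_of_lt hu,
    Nat.div_eq_of_lt hv, add_zero] at h2
  exact Prod.ext (Fin.ext h1) (Fin.ext h2)

-- Within one residue class the position is determined by its quotient by c, which runs through 0,
-- ..., j - 1.
open Classical in
lemma card_strip_mod {w c j r : ℕ} (hw : w ≤ m) (hr : r < c) (hj : c * j ≤ w * m) :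
    Finset.card {v : Fin m × Fin m | InStrip w (c * j) v ∧ stripPos w v % c = r} = j := by
  refine (Finset.card_nbij (t := Finset.range j) (fun v => stripPos w v / c) ?_ ?_ ?_).trans
    (Finset.card_range j)
  · intro v hv
    have hv := (Finset.mem_filter.1 hv).2
    exact Finset.mem_range.2 (Nat.div_lt_of_lt_mul hv.1.2)
  · intro u hu v hv e
    have hu := (Finset.mem_filter.1 hu).2
    have hv := (Finset.mem_filter.1 hv).2
    refine stripPos_injOn hu.1.1 hv.1.1 ?_
    rw [← Nat.div_add_mod (stripPos w u) c, ← Nat.div_add_mod (stripPos w v) c, hu.2, hv.2]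
    simp only at e
    rw [e]
  · intro i hi
    have hi : i < j := by simpa using hi
    have hlt : c * i + r < c * j := by nlinarith
    have hw0 : 0 < w := by
      rcases Nat.eq_zero_or_pos w with h | h
      · subst h; omega
      · exact h
    have hy : (c * i + r) / w < m := Nat.div_lt_of_lt_mul (hlt.trans_le hj)
    have hx : (c * i + r) % w < w := Nat.mod_lt _ hw0
    have hp : stripPos w (m := m) (⟨(c * i + r) % w, hx.trans_le hw⟩, ⟨(c * i + r) / w, hy⟩) =
        c * i + r := by
      unfold stripPos
      rw [mul_comm]
      exact Nat.div_add_mod _ _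
    refine ⟨(⟨(c * i + r) % w, hx.trans_le hw⟩, ⟨(c * i + r) / w, hy⟩),
      Finset.mem_coe.2 (Finset.mem_filter.2 ⟨Finset.mem_univ _, ⟨hx, hp.trans_lt hlt⟩, ?_⟩), ?_⟩
    · rw [hp, Nat.mul_add_mod, Nat.mod_eq_of_lt hr]
    · simp only [hp]
      rw [Nat.mul_add_div (by omega), Nat.div_eq_of_lt hr, add_zero]

open Classical in
lemma card_strip {w N : ℕ} (hw : w ≤ m) (hN : N ≤ w * m) :
    Finset.card {v : Fin m × Fin m | InStrip w N v} = N := by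
  have := card_strip_mod (c := 1) (r := 0) (j := N) hw one_pos (by omega)
  simpa [Nat.mod_one] using this

/-- Of the consecutive numbers m - 1 and m - 2 at most one is divisible by c. -/
lemma exists_width (hm : 3 ≤ m) {c : ℕ} (hc : 2 ≤ c) : ∃ w, w + 1 ≤ m ∧ m ≤ w + 2 ∧ ¬ c ∣ w := by
  by_cases h : c ∣ m - 1
  · refine ⟨m - 2, by omega, by omega, fun h2 => ?_⟩
    have h3 := (Nat.dvd_sub h h2)
    rw [show m - 1 - (m - 2) = 1 by omega] at h3
    have := Nat.le_of_dvd one_pos h3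
    omega
  · exact ⟨m - 1, by omega, by omega, h⟩

-- These are the vertices outside the strip that may have a neighbour inside it: at most two
-- columns, the last row, and the w positions just after the end of the strip.
open Classical in
lemma card_strip_boundary {w N : ℕ} (hw : m ≤ w + 2) :
    Finset.card {v : Fin m × Fin m | w ≤ (v.1 : ℕ) ∨ (v.2 : ℕ) + 1 = m ∨
      ((v.1 : ℕ) < w ∧ N ≤ stripPos w v ∧ stripPos w v < N + w)} ≤ 4 * m := by
  have h1 : Finset.card {v : Fin m × Fin m | w ≤ (v.1 : ℕ)} ≤ 2 * m := by
    have : (Finset.range 2 ×ˢ (Finset.univ : Finset (Fin m))).card = 2 * m := by simp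
    rw [← this]
    refine Finset.card_le_card_of_injOn (fun v => ((v.1 : ℕ) - w, v.2)) ?_ ?_
    · intro v _
      have := v.1.2
      simp
      omega
    · intro u hu v hv e
      simp only [Finset.coe_filter, Finset.mem_univ, true_and, Set.mem_ofPred_eq] at hu hv
      simp only [Prod.mk.injEq] at e
      exact Prod.ext (Fin.ext (by omega)) e.2
  have h2 : Finset.card {v : Fin m × Fin m | (v.2 : ℕ) + 1 = m} ≤ m := by
    conv_rhs => rw [← Finset.card_fin m]
    refine Finset.card_le_card_of_injOn Prod.fst (fun _ _ => Finset.mem_univ _) ?_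
    intro u hu v hv e
    simp only [Finset.coe_filter, Finset.mem_univ, true_and, Set.mem_ofPred_eq] at hu hv
    exact Prod.ext e (Fin.ext (by omega))
  have h3 : Finset.card {v : Fin m × Fin m |
      (v.1 : ℕ) < w ∧ N ≤ stripPos w v ∧ stripPos w v < N + w} ≤ m := by
    conv_rhs => rw [← Finset.card_fin m]
    refine Finset.card_le_card_of_injOn Prod.fst (fun _ _ => Finset.mem_univ _) ?_
    intro u hu v hv e
    simp only [Finset.coe_filter, Finset.mem_univ, true_and, Set.mem_ofPred_eq] at hu hv
    unfold stripPos at hu hv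
    refine Prod.ext e (Fin.ext ?_)
    rw [e] at hu
    rcases lt_trichotomy (u.2 : ℕ) (v.2 : ℕ) with h | h | h
    · have := Nat.mul_le_mul_right w (Nat.succ_le_of_lt h)
      rw [Nat.succ_mul] at this
      omega
    · exact h
    · have := Nat.mul_le_mul_right w (Nat.succ_le_of_lt h)
      rw [Nat.succ_mul] at this
      omega
  rw [Finset.filter_or, Finset.filter_or]
  refine (Finset.card_union_le _ _).trans ?_
  have := Finset.card_union_le {v : Fin m × Fin m | (v.2 : ℕ) + 1 = m} {v : Fin m × Fin m |
      (v.1 : ℕ) < w ∧ N ≤ stripPos w v ∧ stripPos w v < N + w}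
  omega

/-- Away from the boundary, the complement of a strip is closed under taking neighbours. -/
lemma not_inStrip_of_adj (hm : 3 ≤ m) {w N : ℕ} (hw : w + 1 ≤ m) {u v : Fin m × Fin m}
    (hv : ¬ InStrip w N v) (hb : ¬ (w ≤ (v.1 : ℕ) ∨ (v.2 : ℕ) + 1 = m ∨
      ((v.1 : ℕ) < w ∧ N ≤ stripPos w v ∧ stripPos w v < N + w)))
    (h : (torus m).Adj v u) : ¬ InStrip w N u := by
  rintro ⟨hu1, hu2⟩
  push Not at hb
  obtain ⟨hb1, hb2, hb3⟩ := hb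
  have hN : N ≤ stripPos w v := by
    by_contra hc
    exact hv ⟨hb1, by omega⟩
  have hb3 := hb3 hb1 hN
  unfold stripPos at *
  rcases torus_adj_val hm h with ⟨h | h | h | h, e⟩ | ⟨h | h | h | h, e⟩
  · rw [e] at hb3; omega
  · rw [e] at hb3; omega
  · omega
  · omega
  · rw [← h, Nat.succ_mul] at hu2; omega
  · rw [← h, Nat.succ_mul] at hb3; omega
  · rw [h.1] at hb3; omega
  · omega

end Strip

/-! ### Clustered and dispersed colourings -/

section StripColourings

variable {m : ℕ}

open Classical in
/-- A stable colouring with `t` colours in which the last colour occupies a region with short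
boundary and the other vertices have no neighbour of their own colour. -/
lemma exists_stable_clustered (hm : 3 ≤ m) {t k : ℕ} (ht : 3 ≤ t) (hn : m * m = t * k)
    (hk : (t - 1) * k ≤ (m - 2) * (m - 1)) :
    ∃ f : Fin m × Fin m → Fin t, IsBalanced f k ∧ IsStable (torus m) f ∧
      4 * k ≤ monoCount (torus m) f + 16 * m := by
  obtain ⟨w, hw1, hw2, hw3⟩ := exists_width hm (c := t - 1) (by omega)
  have hN : (t - 1) * k ≤ w * (m - 1) := hk.trans (Nat.mul_le_mul_right _ (by omega))
  have hN' : (t - 1) * k ≤ w * m := hN.trans (Nat.mul_le_mul_left _ (by omega))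
  set N := (t - 1) * k with hNdef
  let l : Fin t := ⟨t - 1, by omega⟩
  let f : Fin m × Fin m → Fin t := fun v =>
    if InStrip w N v then ⟨stripPos w v % (t - 1), (Nat.mod_lt _ (by omega)).trans_le (by omega)⟩
    else l
  have hl : ∀ v, f v = l ↔ ¬ InStrip w N v := by
    intro v
    simp only [f]
    split_ifs with h
    · have := Nat.mod_lt (stripPos w v) (by omega : t - 1 > 0)
      simp only [l, Fin.mk.injEq, h, not_true_eq_false, iff_false]
      omega
    · simp [h]
  have hbal : IsBalanced f k := by
    intro c
    by_cases hc : c = l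
    · subst hc
      simp only [hl]
      have h1 := Finset.card_filter_add_card_filter_not (s := Finset.univ)
        (fun v : Fin m × Fin m => InStrip w N v)
      rw [card_strip (by omega) hN'] at h1
      simp only [Finset.card_univ, Fintype.card_prod, Fintype.card_fin] at h1
      have : t * k = N + k := by
        rw [hNdef, ← Nat.succ_mul]; congr 1; omega
      omega
    · have hlt : (c : ℕ) < t - 1 := by
        have := c.2
        have : (c : ℕ) ≠ t - 1 := fun e => hc (Fin.ext e)
        omega
      rw [← card_strip_mod (m := m) (j := k) (by omega : w ≤ m) hlt hN']
      congr 1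
      ext v
      simp only [Finset.mem_filter, Finset.mem_univ, true_and, f]
      by_cases h : InStrip w N v
      · simp [h, ← hNdef, Fin.ext_iff]
      · simp [h, ← hNdef, eq_comm (a := l), hc]
  have hzero : ∀ v, f v ≠ l → typeCount (torus m) f v (f v) = 0 := by
    intro v hv
    have hv' : InStrip w N v := by
      by_contra h
      exact hv ((hl v).2 h)
    unfold typeCount
    refine Finset.sum_eq_zero fun u _ => if_neg ?_
    rintro ⟨ha, hu⟩
    have hu' : InStrip w N u := by
      by_contra h
      exact hv (hu ▸ (hl u).2 h)
    refine hv'.mod_ne hm hw1 hN (by omega) hw3 hu' ha ?_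
    simpa [f, hv', hu', eq_comm] using hu
  refine ⟨f, hbal, fun v w hvw => ?_, ?_⟩
  -- One of the two vertices is not of the last colour, so it has s = 0 and cannot gain from the
  -- swap.
  · by_cases h : f v = l
    · right
      rw [hzero w (fun e => hvw (h.trans e.symm)), zero_add]
      exact adjInd_le_typeCount _ _ _ _
    · left
      rw [hzero v h, zero_add, adjInd_comm]
      exact adjInd_le_typeCount _ _ _ _
  · have hb := card_strip_boundary (N := N) hw2
    have hpt : ∀ v, (if f v = l then 4 else 0) ≤ typeCount (torus m) f v (f v) +
        4 * if (w ≤ (v.1 : ℕ) ∨ (v.2 : ℕ) + 1 = m ∨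
          ((v.1 : ℕ) < w ∧ N ≤ stripPos w v ∧ stripPos w v < N + w)) then 1 else 0 := by
      intro v
      by_cases hv : f v = l
      · by_cases hbv : (w ≤ (v.1 : ℕ) ∨ (v.2 : ℕ) + 1 = m ∨
          ((v.1 : ℕ) < w ∧ N ≤ stripPos w v ∧ stripPos w v < N + w))
        · simp [hv, hbv]
        · rw [if_pos hv, if_neg hbv, hv, typeCount, ← fourRegular_torus hm v]
          refine le_of_eq (Finset.sum_congr rfl fun u _ => ?_)
          by_cases ha : (torus m).Adj v u
          · have := (hl u).2 (not_inStrip_of_adj hm hw1 ((hl v).1 hv) hbv ha)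
            rw [if_pos ha, if_pos ⟨ha, this⟩]
          · rw [if_neg ha, if_neg fun h => ha h.1]
      · simp [hv]
    have hs := Finset.sum_le_sum fun v (_ : v ∈ Finset.univ) => hpt v
    rw [Finset.sum_add_distrib, ← Finset.mul_sum, ← Finset.card_filter,
      hbal.sum_comp (fun c => if c = l then 4 else 0)] at hs
    simp only [Finset.sum_ite_eq', Finset.mem_univ, if_true] at hs
    unfold monoCount
    omega

open Classical in
/-- A balanced colouring with few monochromatic edges. -/
lemma exists_dispersed (hm : 3 ≤ m) {t k : ℕ} (ht : 2 ≤ t) (hn : m * m = t * k) :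
    ∃ f : Fin m × Fin m → Fin t, IsBalanced f k ∧
      monoCount (torus m) f ≤ 8 * (3 * m + t) := by
  obtain ⟨w, hw1, hw2, hw3⟩ := exists_width hm ht
  -- The longest usable strip whose length is a multiple of t; the remaining 3m + t vertices at most
  -- are coloured evenly, without regard to adjacency.
  set j := w * (m - 1) / t with hj
  have hN : t * j ≤ w * (m - 1) := Nat.mul_div_le _ _
  have hN' : t * j ≤ w * m := hN.trans (Nat.mul_le_mul_left _ (by omega))
  have hjk : j ≤ k := by
    have : t * j ≤ t * k := hN'.trans (hn ▸ Nat.mul_le_mul_right _ (by omega))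
    exact Nat.le_of_mul_le_mul_left this (by omega)
  set R : Fin m × Fin m → Prop := InStrip w (t * j) with hR
  have hRc : Finset.card {v | ¬ R v} = t * (k - j) := by
    have h1 := Finset.card_filter_add_card_filter_not (s := Finset.univ)
      (fun v : Fin m × Fin m => InStrip w (t * j) v)
    rw [card_strip (by omega) hN'] at h1
    simp only [Finset.card_univ, Fintype.card_prod, Fintype.card_fin] at h1
    rw [Nat.mul_sub, ← hn]
    simp only [hR]
    omega
  have hsmall : t * (k - j) ≤ 3 * m + t := by
    have h1 : w * (m - 1) < t * (j + 1) := Nat.lt_mul_div_succ _ (by omega)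
    have h2 : (m - 2) * (m - 1) ≤ w * (m - 1) := Nat.mul_le_mul_right _ (by omega)
    have h3 : m * m ≤ (m - 2) * (m - 1) + 3 * m := by
      obtain ⟨n, rfl⟩ : ∃ n, m = n + 3 := ⟨m - 3, by omega⟩
      simp only [show n + 3 - 2 = n + 1 by omega, show n + 3 - 1 = n + 2 by omega]
      nlinarith
    rw [Nat.mul_sub]
    rw [Nat.mul_succ] at h1
    omega
  have ecard : Fintype.card {v // ¬ R v} = Fintype.card (Fin t × Fin (k - j)) := by
    rw [Fintype.card_subtype, hRc]
    simp
  let e := Fintype.equivOfCardEq ecard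
  let f : Fin m × Fin m → Fin t := fun v =>
    if h : R v then ⟨stripPos w v % t, Nat.mod_lt _ (by omega)⟩ else (e ⟨v, h⟩).1
  have hin : ∀ v, R v → (f v : ℕ) = stripPos w v % t := fun v h => by simp [f, h]
  have hout : ∀ v (h : ¬ R v), f v = (e ⟨v, h⟩).1 := fun v h => by simp [f, h]
  refine ⟨f, isBalanced_iff.2 fun c => ?_, ?_⟩
  · have h1 : Finset.card {v | f v = c} = Finset.card {v | f v = c ∧ R v} +
        Finset.card {v | f v = c ∧ ¬ R v} := by
      rw [← Finset.filter_filter, ← Finset.filter_filter,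
        Finset.card_filter_add_card_filter_not]
    have h2 : Finset.card {v | f v = c ∧ R v} = j := by
      rw [← card_strip_mod (m := m) (by omega : w ≤ m) c.2 hN']
      congr 1
      ext v
      simp only [Finset.mem_filter, Finset.mem_univ, true_and]
      rw [and_comm]
      refine and_congr_right fun h => ?_
      rw [Fin.ext_iff, hin v h]
    have h3 : Finset.card {v | f v = c ∧ ¬ R v} = k - j := by
      rw [← Finset.card_fin (k - j)]
      symm
      refine Finset.card_nbij (fun i => ((e.symm (c, i)).1)) ?_ ?_ ?_
      · intro i _
        refine Finset.mem_coe.2 (Finset.mem_filter.2 ⟨Finset.mem_univ _, ?_, (e.symm (c, i)).2⟩)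
        rw [hout _ (e.symm (c, i)).2]
        simp
      · intro i _ i' _ h
        have := e.symm.injective (Subtype.ext h)
        simpa using this
      · intro v hv
        obtain ⟨hv1, hv2⟩ := (Finset.mem_filter.1 hv).2
        refine ⟨(e ⟨v, hv2⟩).2, by simp, ?_⟩
        rw [hout v hv2] at hv1
        simp only [← hv1, Prod.mk.eta, Equiv.symm_apply_apply]
    omega
  · have hG := fourRegular_torus hm
    -- A monochromatic edge has an end outside the strip, so each outside vertex accounts for at
    -- most 8 ordered pairs.
    have hpt : ∀ v u, (if f u = f v then adjInd (torus m) v u else 0) ≤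
        (if ¬ R v then adjInd (torus m) v u else 0) +
          (if ¬ R u then adjInd (torus m) v u else 0) := by
      intro v u
      by_cases hv : R v
      · by_cases hu : R u
        · by_cases ha : (torus m).Adj v u
          · have := hv.mod_ne hm hw1 hN ht hw3 hu ha
            rw [← hin v hv, ← hin u hu] at this
            have h' : f u ≠ f v := fun e => this (by rw [e])
            simp [h']
          · have h0 : adjInd (torus m) v u = 0 := if_neg ha
            rw [h0, ite_self]
            exact Nat.zero_le _
        · simp only [hu, not_false_eq_true, if_true]
          split_ifs <;> omega
      · simp only [hv, not_false_eq_true, if_true]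
        split_ifs <;> omega
    calc monoCount (torus m) f
        ≤ ∑ v, ∑ u, ((if ¬ R v then adjInd (torus m) v u else 0) +
          (if ¬ R u then adjInd (torus m) v u else 0)) := by
          unfold monoCount
          simp only [typeCount_eq_sum_adjInd]
          exact Finset.sum_le_sum fun v _ => Finset.sum_le_sum fun u _ => by
            refine le_trans (le_of_eq ?_) (hpt v u)
            congr
      _ = 8 * (t * (k - j)) := by
          simp only [Finset.sum_add_distrib]
          rw [Finset.sum_comm (f := fun v u => if ¬ R u then adjInd (torus m) v u else 0)]
          have h1 : ∀ v, (∑ u, if ¬ R v then adjInd (torus m) v u else 0) =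
              4 * if ¬ R v then 1 else 0 := by
            intro v
            split_ifs
            · simp
            · rw [hG.sum_adjInd]
          have h2 : ∀ v, (∑ u, if ¬ R v then adjInd (torus m) u v else 0) =
              4 * if ¬ R v then 1 else 0 := by
            intro v
            rw [← h1]
            simp only [adjInd_comm]
          simp only [h1, h2]
          rw [← Finset.mul_sum, ← Finset.card_filter, hRc]
          ring
      _ ≤ _ := Nat.mul_le_mul_left _ hsmall

end StripColourings

/-! ### The two-coloured pattern -/

section Pattern

/-- The rows of a two-coloured pattern, least significant bit first: a `10 × 10` tile bordered by
tiles of side `12`. -/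
def patternRows : List ℕ :=
  [3451684, 1742259, 873673, 3492716, 1485106, 697563, 2970188, 3332918,
    697491, 2971341, 3582756, 1750483, 2708056, 2435494, 1365593, 1190354,
    2992934, 1201865, 1750195, 2976588, 1217715, 2976461]

/-- The vertices of the pattern with at least three neighbours of the other colour in every
continuation, in the format of `patternRows`. -/
def highRows : List ℕ :=
  [847013, 2595410, 1299753, 2870932, 1665354, 976037, 3650130, 1781033,
    3110548, 1309002, 646373, 2608691, 3765160, 2439774, 1375657, 1194546,
    4185317, 3832138, 2543354, 3660799, 4159158, 1809770]

/-- The colour of the pattern at `(i, j)`. -/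
def patternBit (i j : ℕ) : Bool := (patternRows.getD i 0).testBit j

/-- Whether `(i, j)` is marked in `highRows`. -/
def highBit (i j : ℕ) : Bool := (highRows.getD i 0).testBit j

/-- Line `i` of the pattern may be followed by line `r`: each of the blocks `[0, 10)` and `[10, 22)`
may be followed by either block. -/
def MayFollow (i r : ℕ) : Prop := if i = 9 ∨ i = 21 then r = 0 ∨ r = 10 else r = i + 1

instance (i r : ℕ) : Decidable (MayFollow i r) := by unfold MayFollow; infer_instance

/-- The number of neighbours with the colour of `(i, j)`, when line `i` lies between `l` and `r` and
line `j` between `b` and `u`. -/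
def patternSame (l i r b j u : ℕ) : ℕ :=
  (if patternBit r j = patternBit i j then 1 else 0) +
  (if patternBit l j = patternBit i j then 1 else 0) +
  (if patternBit i u = patternBit i j then 1 else 0) +
  (if patternBit i b = patternBit i j then 1 else 0)

/-- The number of neighbours of the same colour that is guaranteed at `(i, j)`. -/
def sameBound (i j : ℕ) : ℕ := if i < 10 ∧ j < 10 then (if highBit i j then 1 else 2) else 0

/-- The local properties of the pattern. -/
def PatternLocal (l i r b j u : ℕ) : Prop :=
  patternSame l i r b j u ≤ (if highBit i j then 1 else 2) ∧
  sameBound i j ≤ patternSame l i r b j u ∧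
  (patternBit r j ≠ patternBit i j → highBit i j ∨ highBit r j) ∧
  (patternBit i u ≠ patternBit i j → highBit i j ∨ highBit i u)

instance (l i r b j u : ℕ) : Decidable (PatternLocal l i r b j u) := by
  unfold PatternLocal; infer_instance

/-- `PatternLocal` for all admissible choices of lines around line `i`. -/
def PatternLocalLine (l i r : ℕ) : Prop :=
  ∀ b < 22, ∀ j < 22, MayFollow b j → ∀ u < 22, MayFollow j u → PatternLocal l i r b j u

instance (l i r : ℕ) : Decidable (PatternLocalLine l i r) := by
  unfold PatternLocalLine; infer_instance

/-- The local conditions involve only a line and its two neighbours in each direction, so a finite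
check covers all tilings by the four kinds of tile. -/
lemma patternLocalLine_of_mayFollow : ∀ l < 22, ∀ i < 22, MayFollow l i → ∀ r < 22,
    MayFollow i r → PatternLocalLine l i r := by
  decide +kernel

/-- The line of the pattern used for line `x` of the torus: `q` blocks of length `10` are followed by
blocks of length `12`. -/
def lineCode (q x : ℕ) : ℕ := if x < 10 * q then x % 10 else 10 + (x - 10 * q) % 12

lemma lineCode_lt (q x : ℕ) : lineCode q x < 22 := by
  unfold lineCode; split_ifs <;> omega

lemma mayFollow_lineCode {m q j : ℕ} [NeZero m] (hm : 3 ≤ m) (hmq : m = 10 * q + 12 * j)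
    (x : Fin m) : MayFollow (lineCode q x) (lineCode q (x + 1 : Fin m)) := by
  rw [fin_add_one_val hm x]
  have := x.2
  unfold MayFollow lineCode
  -- The wrap-around also joins the end of a block to the start of a block; which block comes last
  -- depends on whether j = 0.
  rcases Nat.eq_zero_or_pos j with rfl | hj <;> split_ifs <;> omega

lemma sum_range_mod (F : ℕ → ℕ) (p q : ℕ) :
    ∑ x ∈ Finset.range (p * q), F (x % p) = q * ∑ i ∈ Finset.range p, F i := by
  induction q with
  | zero => simp
  | succ q ih =>
    rw [Nat.mul_succ, Finset.sum_range_add, ih, Nat.succ_mul]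
    congr 1
    refine Finset.sum_congr rfl fun i hi => ?_
    rw [Nat.mul_add_mod, Nat.mod_eq_of_lt (Finset.mem_range.1 hi)]

lemma sum_lineCode (F : ℕ → ℕ) {m q j : ℕ} (hmq : m = 10 * q + 12 * j) :
    ∑ x : Fin m, F (lineCode q x) =
      q * (∑ i ∈ Finset.range 10, F i) + j * ∑ i ∈ Finset.range 12, F (10 + i) := by
  rw [Fin.sum_univ_eq_sum_range (fun x => F (lineCode q x)), hmq, Finset.sum_range_add,
    ← sum_range_mod, ← sum_range_mod (fun i => F (10 + i))]
  congr 1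
  · refine Finset.sum_congr rfl fun x hx => ?_
    rw [lineCode, if_pos (Finset.mem_range.1 hx)]
  · refine Finset.sum_congr rfl fun x _ => ?_
    rw [lineCode, if_neg (by omega), Nat.add_sub_cancel_left]

lemma sum_lineCode_prod (F : ℕ → ℕ → ℕ) {m q j : ℕ} (hmq : m = 10 * q + 12 * j) :
    ∑ v : Fin m × Fin m, F (lineCode q v.1) (lineCode q v.2) =
      q * q * (∑ i ∈ Finset.range 10, ∑ i' ∈ Finset.range 10, F i i') +
      q * j * ((∑ i ∈ Finset.range 10, ∑ i' ∈ Finset.range 12, F i (10 + i')) +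
        ∑ i ∈ Finset.range 12, ∑ i' ∈ Finset.range 10, F (10 + i) i') +
      j * j * ∑ i ∈ Finset.range 12, ∑ i' ∈ Finset.range 12, F (10 + i) (10 + i') := by
  rw [Fintype.sum_prod_type]
  simp only [sum_lineCode _ hmq]
  rw [sum_lineCode (fun i => q * (∑ i' ∈ Finset.range 10, F i i') +
    j * ∑ i' ∈ Finset.range 12, F i (10 + i')) hmq]
  simp only [Finset.sum_add_distrib, ← Finset.mul_sum]
  ring

lemma patternBit_balanced : ∀ c : Bool,
    (∑ i ∈ Finset.range 10, ∑ i' ∈ Finset.range 10, if patternBit i i' = c then 1 else 0) = 50 ∧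
    (∑ i ∈ Finset.range 10, ∑ i' ∈ Finset.range 12,
      if patternBit i (10 + i') = c then 1 else 0) = 60 ∧
    (∑ i ∈ Finset.range 12, ∑ i' ∈ Finset.range 10,
      if patternBit (10 + i) i' = c then 1 else 0) = 60 ∧
    (∑ i ∈ Finset.range 12, ∑ i' ∈ Finset.range 12,
      if patternBit (10 + i) (10 + i') = c then 1 else 0) = 72 := by
  decide +kernel

/-- Sixty vertices with s = 2 and forty with s = 1: the equality case of
`IsStable.monoCount_le_of_two`. -/
lemma sum_sameBound :
    (∑ i ∈ Finset.range 10, ∑ i' ∈ Finset.range 10, sameBound i i') = 160 := by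
  decide +kernel

open Classical in
/-- For two colours and side `10 q + 12 j`, a balanced stable colouring whose welfare exceeds `2.4`
per vertex only because of the `j` exceptional blocks in each direction. -/
lemma exists_stable_pattern {m k q j : ℕ} (hm : 3 ≤ m) (hn : m * m = 2 * k)
    (hmq : m = 10 * q + 12 * j) :
    ∃ f : Fin m × Fin m → Fin 2, IsBalanced f k ∧ IsStable (torus m) f ∧
      160 * (q * q) ≤ monoCount (torus m) f ∧
      (j = 0 → ∀ v w : Fin m × Fin m, (v.1 : ℕ) ≡ (w.1 : ℕ) [MOD 10] →
        (v.2 : ℕ) ≡ (w.2 : ℕ) [MOD 10] → f v = f w) := by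
  have : NeZero m := ⟨by omega⟩
  have hG := fourRegular_torus hm
  let e : Bool → Fin 2 := fun b => if b then 1 else 0
  have he : ∀ a b, e a = e b ↔ a = b := by decide
  have hsurj : ∀ c : Fin 2, ∃ b, c = e b := by decide
  let C : Fin m → ℕ := fun x => lineCode q x
  let f : Fin m × Fin m → Fin 2 := fun v => e (patternBit (C v.1) (C v.2))
  have hf : ∀ v w, f v = f w ↔ patternBit (C v.1) (C v.2) = patternBit (C w.1) (C w.2) :=
    fun v w => he _ _
  have hC : ∀ x, MayFollow (C x) (C (x + 1)) := mayFollow_lineCode hm hmq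
  have hC' : ∀ x, MayFollow (C (x - 1)) (C x) := fun x => by
    have := hC (x - 1)
    rwa [sub_add_cancel] at this
  have hlt : ∀ x, C x < 22 := fun x => lineCode_lt _ _
  have hloc : ∀ v : Fin m × Fin m, PatternLocal (C (v.1 - 1)) (C v.1) (C (v.1 + 1))
      (C (v.2 - 1)) (C v.2) (C (v.2 + 1)) := fun v =>
    patternLocalLine_of_mayFollow _ (hlt _) _ (hlt _) (hC' _) _ (hlt _) (hC _) _ (hlt _) _ (hlt _)
      (hC' _) _ (hlt _) (hC _)
  have hsame : ∀ v : Fin m × Fin m, typeCount (torus m) f v (f v) =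
      patternSame (C (v.1 - 1)) (C v.1) (C (v.1 + 1)) (C (v.2 - 1)) (C v.2) (C (v.2 + 1)) := by
    intro v
    rw [typeCount_torus hm]
    simp only [hf]
    unfold patternSame
    congr
  have hle : ∀ v : Fin m × Fin m, typeCount (torus m) f v (f v) ≤
      if highBit (C v.1) (C v.2) then 1 else 2 := fun v => (hsame v).trans_le (hloc v).1
  have hedge : ∀ v w, (torus m).Adj v w → f w ≠ f v →
      highBit (C v.1) (C v.2) ∨ highBit (C w.1) (C w.2) := by
    intro v w ha hne
    rw [Ne, hf] at hne
    rw [torus_adj_iff hm] at ha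
    simp only [Finset.mem_insert, Finset.mem_singleton] at ha
    rcases ha with rfl | rfl | rfl | rfl
    · exact (hloc v).2.2.1 hne
    · have := (hloc (v.1 - 1, v.2)).2.2.1
      simp only [sub_add_cancel] at this
      exact (this (Ne.symm hne)).symm
    · exact (hloc v).2.2.2 hne
    · have := (hloc (v.1, v.2 - 1)).2.2.2
      simp only [sub_add_cancel] at this
      exact (this (Ne.symm hne)).symm
  refine ⟨f, isBalanced_iff.2 fun c => ?_, fun v w hvw => ?_, ?_, ?_⟩
  · obtain ⟨b, rfl⟩ := hsurj c
    obtain ⟨h1, h2, h3, h4⟩ := patternBit_balanced b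
    rw [Finset.card_filter]
    simp only [f, he, C]
    rw [sum_lineCode_prod (fun i i' => if patternBit i i' = b then 1 else 0) hmq, h1, h2, h3, h4]
    subst hmq
    nlinarith
  · have hopp : ∀ x y, f x ≠ f y →
        typeCount (torus m) f x (f x) + typeCount (torus m) f x (f y) = 4 := by
      intro x y hxy
      rw [← sum_typeCount hG f x, ← Finset.sum_pair (f := fun c => typeCount (torus m) f x c) hxy]
      congr 1
      generalize f x = a at hxy
      generalize f y = b at hxy
      revert a b
      decide
    -- With two colours the first alternative reads s(v) + s(w) + adjacency ≤ 4. This holds as all s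
    -- ≤ 2, and one end of each bichromatic edge has s ≤ 1.
    left
    have h1 := hopp w v hvw.symm
    have h2 := hle v
    have h3 := hle w
    by_cases ha : (torus m).Adj v w
    · have h4 := hedge v w ha hvw.symm
      have h5 : adjInd (torus m) v w = 1 := if_pos ha
      rcases h4 with h4 | h4 <;> simp only [h4, if_true] at h2 h3 <;> split_ifs at * <;> omega
    · have h5 : adjInd (torus m) v w = 0 := if_neg ha
      split_ifs at * <;> omega
  · calc 160 * (q * q) ≤ ∑ v : Fin m × Fin m, sameBound (lineCode q v.1) (lineCode q v.2) := by
          rw [sum_lineCode_prod sameBound hmq, sum_sameBound]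
          exact (le_of_eq (mul_comm _ _)).trans
            ((Nat.le_add_right _ _).trans (Nat.le_add_right _ _))
      _ ≤ monoCount (torus m) f := Finset.sum_le_sum fun v _ => by
          rw [hsame v]
          exact (hloc v).2.1
  · intro hj v w h1 h2
    have hx : ∀ x : Fin m, C x = (x : ℕ) % 10 := fun x => by
      have := x.2
      simp only [C, lineCode]
      rw [if_pos (by omega)]
    rw [hf, hx, hx, hx, hx, h1, h2]

end Pattern

/-! ### Estimating the price of anarchy -/

section PriceOfAnarchy

variable {X V : Type*}

lemma priceOfAnarchy_le {U : Utility X V} {μ : Assignment X V → ℝ}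
    {a b : ℝ} (hb : 0 < b) (hne : (equilibria U).Nonempty) (hlow : ∀ L ∈ equilibria U, b ≤ μ L)
    (hup : ∀ L, μ L ≤ a) (ha : 0 ≤ a) : priceOfAnarchy μ U ≤ a / b := by
  obtain ⟨L, hL⟩ := hne
  refine div_le_div₀ ha (csSup_le ⟨_, ⟨L, rfl⟩⟩ ?_) hb (le_csInf ⟨_, ⟨L, hL, rfl⟩⟩ ?_)
  · rintro _ ⟨L, rfl⟩
    exact hup L
  · rintro _ ⟨L, hL, rfl⟩
    exact hlow L hL

/-- Finiteness makes the infimum an attained value, hence positive, and the supremum a genuine upper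
bound. -/
lemma le_priceOfAnarchy [Finite X] [Finite V] {U : Utility X V} {μ : Assignment X V → ℝ}
    {L₀ L₁ : Assignment X V} (h₁ : L₁ ∈ equilibria U) (hpos : ∀ L ∈ equilibria U, 0 < μ L)
    (h₀ : 0 ≤ μ L₀) : μ L₀ / μ L₁ ≤ priceOfAnarchy μ U := by
  classical
  have hfin : (μ '' equilibria U).Finite := Set.toFinite _
  have hmem := hfin.isCompact.sInf_mem ⟨_, ⟨L₁, h₁, rfl⟩⟩
  obtain ⟨L, hL, e⟩ := hmem
  have h0 : μ L₀ ≤ sSup (Set.range μ) := le_csSup (Set.finite_range μ).bddAbove ⟨L₀, rfl⟩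
  refine div_le_div₀ (h₀.trans h0) h0 ?_ (csInf_le hfin.bddBelow ⟨L₁, h₁, rfl⟩)
  rw [← e]
  exact hpos L hL

/-- If the optimum is `4 m² - O(m)` and some equilibrium has welfare `a m² + O(m)`, then the ratio is
asymptotically at least `4 / a`. -/
lemma exists_lt_ratio {a C ε : ℝ} (ha : 0 < a) (hC : 0 < C) (hε : 0 < ε) :
    ∃ M : ℕ, ∀ m : ℕ, M ≤ m → ∀ S₀ S₁ : ℝ, 4 * (m : ℝ) ^ 2 - C * m ≤ S₀ → 0 ≤ S₀ → 0 < S₁ →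
      S₁ ≤ a * (m : ℝ) ^ 2 + C * m → 4 / a - ε < S₀ / S₁ := by
  have hlim : Filter.Tendsto (fun m : ℕ => (4 - C / (m : ℝ)) / (a + C / (m : ℝ))) Filter.atTop
      (nhds (4 / a)) := by
    have h0 := tendsto_const_div_atTop_nhds_zero_nat C
    have h1 := (tendsto_const_nhds (x := (4 : ℝ))).sub h0
    have h2 := (tendsto_const_nhds (x := a)).add h0
    have := h1.div h2 (by simpa using ha.ne')
    simp only [sub_zero, add_zero] at this
    exact this
  have hev := hlim.eventually (lt_mem_nhds (sub_lt_self (4 / a) hε))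
  obtain ⟨M, hM⟩ := Filter.eventually_atTop.1 hev
  refine ⟨max M 1, fun m hm S₀ S₁ h0 h0' h1 h1' => ?_⟩
  have hm0 : (0 : ℝ) < m := by
    have : 1 ≤ m := (le_max_right _ _).trans hm
    exact_mod_cast this
  refine (hM m ((le_max_left _ _).trans hm)).trans_le ?_
  have e : (4 - C / (m : ℝ)) / (a + C / (m : ℝ)) =
      (4 * (m : ℝ) ^ 2 - C * m) / (a * (m : ℝ) ^ 2 + C * m) := by
    field_simp
  rw [e]
  exact div_le_div₀ h0' h0 h1 h1'

end PriceOfAnarchy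

/-! ### Welfare and price of anarchy of the torus games -/

section TorusGame

variable {X : Type*} [Fintype X] {t m k : ℕ} {type : X → Fin t}

lemma IsTorusGame.pos (h : IsTorusGame m k type) : 0 < k := by
  obtain ⟨hm, hn, -, -⟩ := h
  rcases Nat.eq_zero_or_pos k with rfl | hk
  · nlinarith
  · exact hk

-- Here n/t = k exactly, so every class has at least k agents; the total tk leaves no room for k +
-- 1.
open Classical in
lemma IsTorusGame.card_type (h : IsTorusGame m k type) (ht : 0 < t) (c : Fin t) :
    Fintype.card {A // type A = c} = k := by
  obtain ⟨hm, hn, hX, heq⟩ := h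
  have hdiv : Fintype.card X / t = k := by rw [hX, Nat.mul_div_cancel_left _ ht]
  have hge : ∀ i, k ≤ Fintype.card {A // type A = i} := by
    intro i
    have := heq i
    rw [hdiv, Nat.card_eq_fintype_card] at this
    omega
  have hsum : ∑ i, Fintype.card {A // type A = i} = ∑ _i : Fin t, k := by
    rw [← Fintype.card_sigma, Fintype.card_congr (Equiv.sigmaFiberEquiv type), hX]
    simp
  exact ((Finset.sum_eq_sum_iff_of_le fun i _ => hge i).1 hsum.symm c (Finset.mem_univ c)).symm

lemma IsTorusGame.fourRegular (h : IsTorusGame m k type) : FourRegular (torus m) :=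
  fourRegular_torus h.1

lemma IsTorusGame.isBalanced (h : IsTorusGame m k type) (ht : 0 < t)
    (L : Assignment X (Fin m × Fin m)) : IsBalanced (type ∘ L.symm) k := by
  classical
  refine isBalanced_iff.2 fun c => ?_
  rw [← h.card_type ht c, ← Fintype.card_subtype]
  exact Fintype.card_congr (L.symm.subtypeEquiv fun v => Iff.rfl)

lemma IsTorusGame.exists_assignment (h : IsTorusGame m k type) (ht : 0 < t)
    {f : Fin m × Fin m → Fin t} (hf : IsBalanced f k) :
    ∃ L : Assignment X (Fin m × Fin m), type ∘ L.symm = f := by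
  classical
  refine DiversitySwap.exists_assignment type f fun c => ?_
  trans k
  · convert h.card_type ht c
  · rw [Fintype.card_subtype, ← isBalanced_iff.1 hf c]

lemma IsTorusGame.socialWelfare_eq (h : IsTorusGame m k type) (L : Assignment X (Fin m × Fin m)) :
    socialWelfare (torusU m type) L = 4 * (t * k) - (monoCount (torus m) (type ∘ L.symm) : ℝ) := by
  have := socialWelfare_add h.fourRegular type L
  rw [h.2.2.1] at this
  push_cast at this
  linarith

lemma IsTorusGame.nonempty_equilibria (h : IsTorusGame m k type) :
    (equilibria (torusU m type)).Nonempty :=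
  equilibria_nonempty h.fourRegular type (by rw [h.2.2.1, ← h.2.1]; simp)

lemma IsTorusGame.socialWelfare_le (h : IsTorusGame m k type) (L : Assignment X (Fin m × Fin m)) :
    socialWelfare (torusU m type) L ≤ 4 * (t * k) := by
  rw [h.socialWelfare_eq]
  have : (0 : ℝ) ≤ monoCount (torus m) (type ∘ L.symm) := Nat.cast_nonneg _
  linarith

lemma socialWelfare_torusU_nonneg (type : X → Fin t)
    (L : Assignment X (Fin m × Fin m)) : 0 ≤ socialWelfare (torusU m type) L :=
  Finset.sum_nonneg fun _ _ => Nat.cast_nonneg _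

lemma IsTorusGame.three_mul_le (h : IsTorusGame m k type) (ht : 0 < t)
    {L : Assignment X (Fin m × Fin m)} (hL : L ∈ equilibria (torusU m type)) :
    3 * ((t : ℝ) - 1) * k ≤ socialWelfare (torusU m type) L := by
  have h1 := ((mem_equilibria_iff h.fourRegular type L).1 hL).monoCount_le h.fourRegular
    (h.isBalanced ht L)
  rw [Fintype.card_fin] at h1
  have h2 : (monoCount (torus m) (type ∘ L.symm) : ℝ) ≤ (t + 3) * k := by exact_mod_cast h1
  rw [h.socialWelfare_eq]
  linarith

/-- The bound 12k even gives (4t - 12)k; the constant 13 is what the ratio t/(t - 13/4) requires. -/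
lemma IsTorusGame.four_mul_sub_le (h : IsTorusGame m k type) (ht : 0 < t)
    {L : Assignment X (Fin m × Fin m)} (hL : L ∈ equilibria (torusU m type)) :
    (4 * (t : ℝ) - 13) * k ≤ socialWelfare (torusU m type) L := by
  have h1 := ((mem_equilibria_iff h.fourRegular type L).1 hL).monoCount_le_twelve h.fourRegular
    (h.isBalanced ht L)
  have h2 : (monoCount (torus m) (type ∘ L.symm) : ℝ) ≤ 12 * k := by exact_mod_cast h1
  have h3 : (0 : ℝ) ≤ k := Nat.cast_nonneg _
  rw [h.socialWelfare_eq]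
  linarith

lemma IsTorusGame.le_of_two {type : X → Fin 2} (h : IsTorusGame m k type)
    {L : Assignment X (Fin m × Fin m)} (hL : L ∈ equilibria (torusU m type)) :
    (24 / 5 : ℝ) * k ≤ socialWelfare (torusU m type) L := by
  have h1 := ((mem_equilibria_iff h.fourRegular type L).1 hL).monoCount_le_of_two h.fourRegular
    (h.isBalanced two_pos L)
  have h2 : 5 * (monoCount (torus m) (type ∘ L.symm) : ℝ) ≤ 16 * k := by exact_mod_cast h1
  rw [h.socialWelfare_eq]
  push_cast
  linarith

/-- Some assignment has welfare `4 m² - O(m)`. -/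
lemma IsTorusGame.exists_dispersed (h : IsTorusGame m k type) (ht : 2 ≤ t) :
    ∃ L : Assignment X (Fin m × Fin m),
      4 * (m : ℝ) ^ 2 - (24 + 8 * t) * m ≤ socialWelfare (torusU m type) L := by
  obtain ⟨f, hf, hmono⟩ := DiversitySwap.exists_dispersed h.1 ht h.2.1
  obtain ⟨L, rfl⟩ := h.exists_assignment (by omega) hf
  refine ⟨L, ?_⟩
  have h1 : (monoCount (torus m) (type ∘ L.symm) : ℝ) ≤ 8 * (3 * m + t) := by exact_mod_cast hmono
  have h2 : (m : ℝ) * m = t * k := by exact_mod_cast h.2.1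
  have h3 : (t : ℝ) ≤ t * m := by
    have : (3 : ℝ) ≤ m := by exact_mod_cast h.1
    nlinarith [Nat.cast_nonneg (α := ℝ) t]
  rw [h.socialWelfare_eq]
  nlinarith

lemma IsTorusGame.le_side (h : IsTorusGame m k type) (ht : 0 < t) {M : ℕ} (hk : M * M ≤ k) :
    M ≤ m := by
  have h1 := h.2.1
  have h2 : k ≤ t * k := Nat.le_mul_of_pos_left k ht
  exact Nat.mul_self_le_mul_self_iff.1 (by omega)

lemma exists_clustered_ratio (ht : 3 ≤ t) {ε : ℝ} (hε : 0 < ε) :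
    ∃ K : ℕ, ∀ (m k : ℕ) (X : Type) [Fintype X] (type : X → Fin t),
      K ≤ k → IsTorusGame m k type → (t : ℝ) / ((t : ℝ) - 1) - ε < torusPoA m type := by
  have ht' : (3 : ℝ) ≤ t := by exact_mod_cast ht
  have ha : (0 : ℝ) < 4 * ((t : ℝ) - 1) / t := by
    apply div_pos <;> linarith
  obtain ⟨M, hM⟩ := exists_lt_ratio (C := 24 + 8 * t) ha (by positivity) hε
  refine ⟨max M (3 * t) * max M (3 * t), fun m k X _ type hk h => ?_⟩
  have hmM := h.le_side (by omega) hk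
  have hmt : 3 * t ≤ m := (le_max_right _ _).trans hmM
  have hk3 : 3 * m ≤ k := by
    have : t * (3 * m) ≤ t * k := by
      rw [← h.2.1, ← mul_assoc, mul_comm t 3]
      exact Nat.mul_le_mul_right _ hmt
    exact Nat.le_of_mul_le_mul_left this (by omega)
  -- Since m² = tk, the left side is m² - k, and 3m ≤ k suffices.
  have hroom : (t - 1) * k ≤ (m - 2) * (m - 1) := by
    have h1 := h.2.1
    obtain ⟨n, rfl⟩ : ∃ n, m = n + 2 := ⟨m - 2, by omega⟩
    obtain ⟨s, rfl⟩ : ∃ s, t = s + 1 := ⟨t - 1, by omega⟩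
    simp only [Nat.add_sub_cancel, show n + 2 - 1 = n + 1 by omega]
    nlinarith
  obtain ⟨f, hf, hstab, hmono⟩ := exists_stable_clustered h.1 ht h.2.1 hroom
  obtain ⟨L₁, rfl⟩ := h.exists_assignment (by omega) hf
  have hL₁ := (mem_equilibria_iff h.fourRegular type L₁).2 hstab
  obtain ⟨L₀, hL₀⟩ := h.exists_dispersed (by omega)
  have hkpos : (0 : ℝ) < k := by exact_mod_cast h.pos
  have hpos : ∀ L ∈ equilibria (torusU m type), 0 < socialWelfare (torusU m type) L :=
    fun L hL => (mul_pos (by linarith) hkpos).trans_le (h.three_mul_le (by omega) hL)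
  have hle := le_priceOfAnarchy hL₁ hpos (socialWelfare_torusU_nonneg type L₀)
  refine lt_of_lt_of_le ?_ hle
  have e : (t : ℝ) / ((t : ℝ) - 1) = 4 / (4 * ((t : ℝ) - 1) / t) := by
    have : (t : ℝ) - 1 ≠ 0 := by linarith
    field_simp
  rw [e]
  refine hM m ((le_max_left _ _).trans hmM) _ _ hL₀ (socialWelfare_torusU_nonneg type L₀) (hpos _ hL₁) ?_
  have h1 : 4 * (k : ℝ) ≤ monoCount (torus m) (type ∘ L₁.symm) + 16 * m := by exact_mod_cast hmono
  have h2 : (m : ℝ) * m = t * k := by exact_mod_cast h.2.1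
  have h3 : 4 * ((t : ℝ) - 1) / t * (m : ℝ) ^ 2 = 4 * (t - 1) * k := by
    rw [pow_two, h2]
    field_simp
  have h4 : (0 : ℝ) ≤ (t : ℝ) * m := by positivity
  have h5 : (0 : ℝ) ≤ m := by positivity
  rw [h3, h.socialWelfare_eq]
  nlinarith

lemma exists_pattern_ratio {ε : ℝ} (hε : 0 < ε) :
    ∃ K : ℕ, ∀ (m k : ℕ) (X : Type) [Fintype X] (type : X → Fin 2),
      K ≤ k → IsTorusGame m k type → (5 / 3 : ℝ) - ε < torusPoA m type := by
  -- As q = (m - 12j)/10 with j ≤ 4, the welfare 4m² - `monoCount` is at most 4m² - 160q² ≤ 12m²/5 +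
  -- 153.6m; `C` also covers the 40m of the dispersed assignment.
  obtain ⟨M, hM⟩ := exists_lt_ratio (a := 12 / 5) (C := 160) (by norm_num) (by norm_num) hε
  refine ⟨max M 48 * max M 48, fun m k X _ type hk h => ?_⟩
  have hmM := h.le_side two_pos hk
  have hm48 : 48 ≤ m := (le_max_right _ _).trans hmM
  have heven : m % 2 = 0 := by
    have h1 : 2 ∣ m * m := ⟨k, h.2.1⟩
    have := (Nat.prime_two.dvd_mul.1 h1)
    omega
  -- For even m, half the last digit of m is the right number of blocks of length 12; 48 ≤ m leaves
  -- room for four of them.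
  obtain ⟨q, j, hj, hmq⟩ : ∃ q j, j ≤ 4 ∧ m = 10 * q + 12 * j :=
    ⟨(m - 12 * (m % 10 / 2)) / 10, m % 10 / 2, by omega, by omega⟩
  obtain ⟨f, hf, hstab, hmono, -⟩ := exists_stable_pattern h.1 h.2.1 hmq
  obtain ⟨L₁, rfl⟩ := h.exists_assignment two_pos hf
  have hL₁ := (mem_equilibria_iff h.fourRegular type L₁).2 hstab
  obtain ⟨L₀, hL₀⟩ := h.exists_dispersed le_rfl
  have hkpos : (0 : ℝ) < k := by exact_mod_cast h.pos
  have hpos : ∀ L ∈ equilibria (torusU m type), 0 < socialWelfare (torusU m type) L :=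
    fun L hL => (mul_pos (by norm_num) hkpos).trans_le (h.le_of_two hL)
  refine lt_of_lt_of_le ?_ (le_priceOfAnarchy hL₁ hpos (socialWelfare_torusU_nonneg type L₀))
  rw [show (5 / 3 : ℝ) = 4 / (12 / 5) by norm_num]
  have hm0 : (0 : ℝ) ≤ m := Nat.cast_nonneg _
  refine hM m ((le_max_left _ _).trans hmM) _ _ ?_ (socialWelfare_torusU_nonneg type L₀) (hpos _ hL₁) ?_
  · refine le_trans ?_ hL₀
    push_cast
    linarith
  · have h1 : 160 * ((q : ℝ) * q) ≤ monoCount (torus m) (type ∘ L₁.symm) := by exact_mod_cast hmono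
    have h2 : (m : ℝ) * m = 2 * k := by exact_mod_cast h.2.1
    have h3 : 10 * (q : ℝ) = m - 12 * j := by
      rw [hmq]; push_cast; ring
    have h4 : (j : ℝ) ≤ 4 := by exact_mod_cast hj
    have h5 : 100 * ((q : ℝ) * q) = (m - 12 * j) ^ 2 := by rw [← h3]; ring
    have h6 : (j : ℝ) * m ≤ 4 * m := mul_le_mul_of_nonneg_right h4 hm0
    rw [h.socialWelfare_eq]
    push_cast
    nlinarith [sq_nonneg (j : ℝ)]

lemma IsTorusGame.exists_pattern_equilibrium {type : X → Fin 2} (h : IsTorusGame m k type)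
    (hm : 10 ∣ m) : ∃ L ∈ equilibria (torusU m type),
      (∀ v w : Fin m × Fin m, (v.1 : ℕ) ≡ (w.1 : ℕ) [MOD 10] →
        (v.2 : ℕ) ≡ (w.2 : ℕ) [MOD 10] → type (L.symm v) = type (L.symm w)) ∧
      socialWelfare (torusU m type) L = (24 / 5 : ℝ) * k := by
  obtain ⟨q, hq⟩ := hm
  obtain ⟨f, hf, hstab, hmono, hper⟩ :=
    exists_stable_pattern (q := q) (j := 0) h.1 h.2.1 (by omega)
  obtain ⟨L, rfl⟩ := h.exists_assignment two_pos hf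
  have hL := (mem_equilibria_iff h.fourRegular type L).2 hstab
  refine ⟨L, hL, hper rfl, le_antisymm ?_ (h.le_of_two hL)⟩
  have h1 : 160 * ((q : ℝ) * q) ≤ monoCount (torus m) (type ∘ L.symm) := by exact_mod_cast hmono
  have h2 : (m : ℝ) * m = 2 * k := by exact_mod_cast h.2.1
  have h3 : (m : ℝ) = 10 * q := by exact_mod_cast hq
  rw [h3] at h2
  rw [h.socialWelfare_eq]
  push_cast
  linarith

lemma IsTorusGame.torusPoA_le {b : ℝ} (h : IsTorusGame m k type) (ht : 0 < t) (hb : 0 < b)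
    (hlow : ∀ L ∈ equilibria (torusU m type), b * k ≤ socialWelfare (torusU m type) L) :
    torusPoA m type ≤ 4 * t / b := by
  have hkpos : (0 : ℝ) < k := by exact_mod_cast h.pos
  have := priceOfAnarchy_le (mul_pos hb hkpos) h.nonempty_equilibria hlow h.socialWelfare_le
    (by positivity)
  rwa [← mul_assoc, mul_div_mul_right _ _ hkpos.ne'] at this

end TorusGame
end DiversitySwap

theorem mainTheorem8 :
    -- two types
    ((∀ (m k : ℕ) (X : Type) [Fintype X] (type : X → Fin 2),
        DiversitySwap.IsTorusGame m k type →
          (DiversitySwap.equilibria (DiversitySwap.torusU m type)).Nonempty ∧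
          (∀ L ∈ DiversitySwap.equilibria (DiversitySwap.torusU m type),
            (24 / 5 : ℝ) * (k : ℝ) ≤
              DiversitySwap.socialWelfare (DiversitySwap.torusU m type) L) ∧
          (10 ∣ m → ∃ L ∈ DiversitySwap.equilibria (DiversitySwap.torusU m type),
            (∀ v w : Fin m × Fin m, (v.1 : ℕ) ≡ (w.1 : ℕ) [MOD 10] →
              (v.2 : ℕ) ≡ (w.2 : ℕ) [MOD 10] → type (L.symm v) = type (L.symm w)) ∧
            DiversitySwap.socialWelfare (DiversitySwap.torusU m type) L =
              (24 / 5 : ℝ) * (k : ℝ))) ∧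
      (∀ ε : ℝ, 0 < ε → ∃ K : ℕ, ∀ (m k : ℕ) (X : Type) [Fintype X] (type : X → Fin 2),
        K ≤ k → DiversitySwap.IsTorusGame m k type →
          |DiversitySwap.torusPoA m type - 5 / 3| < ε)) ∧
    -- at least three types
    (∀ t : ℕ, 3 ≤ t →
      (∀ (m k : ℕ) (X : Type) [Fintype X] (type : X → Fin t),
        DiversitySwap.IsTorusGame m k type →
          (DiversitySwap.equilibria (DiversitySwap.torusU m type)).Nonempty ∧
          (∀ L ∈ DiversitySwap.equilibria (DiversitySwap.torusU m type),
            0 < DiversitySwap.socialWelfare (DiversitySwap.torusU m type) L) ∧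
          DiversitySwap.torusPoA m type ≤ (4 / 3 : ℝ) * ((t : ℝ) / ((t : ℝ) - 1)) ∧
          (4 ≤ t → DiversitySwap.torusPoA m type ≤
            min ((t : ℝ) / ((t : ℝ) - 13 / 4)) ((4 / 3 : ℝ) * ((t : ℝ) / ((t : ℝ) - 1))))) ∧
      (∀ ε : ℝ, 0 < ε → ∃ K : ℕ, ∀ (m k : ℕ) (X : Type) [Fintype X] (type : X → Fin t),
        K ≤ k → DiversitySwap.IsTorusGame m k type →
          (t : ℝ) / ((t : ℝ) - 1) - ε < DiversitySwap.torusPoA m type)) := by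
  refine ⟨⟨fun m k X _ type h => ⟨h.nonempty_equilibria, fun L hL => h.le_of_two hL,
    h.exists_pattern_equilibrium⟩, fun ε hε => ?_⟩, fun t ht => ⟨fun m k X _ type h => ?_,
    fun ε hε => DiversitySwap.exists_clustered_ratio ht hε⟩⟩
  · obtain ⟨K, hK⟩ := DiversitySwap.exists_pattern_ratio hε
    refine ⟨K, fun m k X _ type hk h => abs_lt.2 ⟨?_, ?_⟩⟩
    · linarith [hK m k X type hk h]
    · have := h.torusPoA_le two_pos (b := 24 / 5) (by norm_num) fun L hL => h.le_of_two hL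
      push_cast at this
      norm_num at this
      linarith
  · have ht' : (3 : ℝ) ≤ t := by exact_mod_cast ht
    have ht0 : 0 < t := by omega
    have hkpos : (0 : ℝ) < k := by exact_mod_cast h.pos
    have hb : (0 : ℝ) < 3 * ((t : ℝ) - 1) := by linarith
    have h1 : DiversitySwap.torusPoA m type ≤ (4 / 3 : ℝ) * ((t : ℝ) / ((t : ℝ) - 1)) := by
      rw [div_mul_div_comm]
      exact h.torusPoA_le ht0 hb fun L hL => h.three_mul_le ht0 hL
    refine ⟨h.nonempty_equilibria,
      fun L hL => (mul_pos hb hkpos).trans_le (h.three_mul_le ht0 hL), h1, fun ht4 => le_min ?_ h1⟩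
    have ht4' : (4 : ℝ) ≤ t := by exact_mod_cast ht4
    have e : (t : ℝ) / ((t : ℝ) - 13 / 4) = 4 * t / (4 * t - 13) := by
      rw [div_eq_div_iff (by linarith) (by linarith)]
      ring
    rw [e]
    exact h.torusPoA_le ht0 (by linarith) fun L hL => h.four_mul_sub_le ht0 hL
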